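/- **Theorem 2.1.** Let $x$ be a root of unity, $a\in\mathbb{C}\setminus\mathbb{Z}$ and $q\in\mathbb{N}=\{1,2,\dots\}$ with $(q,x)\neq(1,1)$. Then $$\sum_{n=-\infty}^{\infty}\frac{4^{n+a}}{(n+a)^q\binom{2n+2a}{n+a}}x^{-n}-(-1)^q\bigl(\mathrm{Li}_1(x;1-a)-x\,\mathrm{Li}_1(x^{-1};a)\bigr)\sum_{n=1}^\infty\frac{\binom{2n}{n}}{n^{q-1}4^n}x^n$$ $$=\sum_{\substack{k_1+\cdots+k_5=q-1\\ k_j\ge 0}}\frac{C_{k_1}C_{k_2}D_{k_3}2^{k_3+k_4}}{k_1!\,k_2!\,k_3!\,k_4!}\log^{k_4}(2)\,\bigl(x\,\mathrm{Li}_{k_5+1}(x^{-1};a)-(-1)^{k_5}\mathrm{Li}_{k_5+1}(x;1-a)\bigr),$$ where all the series involved converge (in general only conditionally; a series over $\mathbb{Z}$ is the limit of its sums over $-M\le n\le N$ as $M,N\to\infty$ independently). Here: - $\binom{u}{v}=\frac{\Gamma(u+1)}{\Gamma(v+1)\Gamma(u-v+1)}$, and $\binom{2n+2a}{n+a}^{-1}$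 is interpreted as $0$ when $2n+2a$ is a negative integer. - $\mathrm{Li}_p(x;c)=\sum_{n=1}^\infty\frac{x^n}{(n+c-1)^p}$ for $p\in\mathbb{N}$, $(p,x)\ne(1,1)$, $c\notin\{0,-1,-2,\dots\}$. When $x=1$, the differences $\mathrm{Li}_1(1;1-a)-\mathrm{Li}_1(1;a)$ and $\mathrm{Li}_1(1;a)-\mathrm{Li}_1(1;1-a)$ are interpreted as the limits of the differences of the partial sums, i.e. as $\pm\sum_{n\ge1}\bigl(\frac1{n-a}-\frac1{n+a-1}\bigr)$. - $C_n=Y_n\bigl(0,1!\,\zeta(2),-2!\,\zeta(3),\ldots,(-1)^n(n-1)!\,\zeta(n)\bigr)$ and $D_n=Y_n\bigl(0,-1!\,\zeta(2),2!\,\zeta(3),\ldots,(-1)^{n-1}(n-1)!\,\zeta(n)\bigr)$, where $\zeta$ is the Riemann zeta function and the exponential complete Bell polynomials $Y_n$ are defined by $\exp\bigl(\sum_{k\ge1}x_k\frac{t^k}{k!}\bigr)=\sum_{n\ge0}Y_n(x_1,\ldots,x_n)\frac{t^n}{n!}$. -/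

import Mathlib

open SummationFilter
open scoped Nat

noncomputable section

/-- The formal power series `∑_{k ≥ 1} x_k t^k / k!`. -/
def bellExponent (x : ℕ → ℂ) : PowerSeries ℂ :=
  PowerSeries.mk fun k => if k = 0 then 0 else x k / (k ! : ℂ)

/-- The exponent has zero constant term, so it may be substituted into the exponential series. -/
theorem hasSubst_bellExponent (x : ℕ → ℂ) : PowerSeries.HasSubst (bellExponent x) :=
  PowerSeries.HasSubst.of_constantCoeff_zero' (by
    rw [← PowerSeries.coeff_zero_eq_constantCoeff_apply]; simp [bellExponent])

/-- The exponential complete Bell polynomial `Y_n(x_1, …, x_n)`, defined by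
`exp (∑_{k ≥ 1} x_k t^k / k!) = ∑_{n ≥ 0} Y_n(x_1, …, x_n) t^n / n!`. -/
def completeBell (n : ℕ) (x : ℕ → ℂ) : ℂ :=
  (n ! : ℂ) * PowerSeries.coeff n ((PowerSeries.exp ℂ).subst (bellExponent x))

/-- `C_n = Y_n(0, 1! ζ(2), -2! ζ(3), …, (-1)^n (n-1)! ζ(n))`. -/
def bellC (n : ℕ) : ℂ :=
  completeBell n fun k => if k = 1 then 0 else (-1) ^ k * ((k - 1)! : ℂ) * riemannZeta (k : ℂ)

/-- `D_n = Y_n(0, -1! ζ(2), 2! ζ(3), …, (-1)^(n-1) (n-1)! ζ(n))`. -/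
def bellD (n : ℕ) : ℂ :=
  completeBell n fun k =>
    if k = 1 then 0 else (-1) ^ (k - 1) * ((k - 1)! : ℂ) * riemannZeta (k : ℂ)

/-- The generalized binomial coefficient `Γ(u+1) / (Γ(v+1) Γ(u-v+1))`. -/
def genBinom (u v : ℂ) : ℂ :=
  Complex.Gamma (u + 1) / (Complex.Gamma (v + 1) * Complex.Gamma (u - v + 1))

/-- The term of index `n` of the bilateral series,
`4^(n+a) x^(-n) / ((n+a)^q binom(2n+2a, n+a))`. -/
def aperyTerm (q : ℕ) (x a : ℂ) (n : ℤ) : ℂ :=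
  (4 : ℂ) ^ ((n : ℂ) + a) / (((n : ℂ) + a) ^ q * genBinom (2 * n + 2 * a) (n + a)) * x ^ (-n)

/-- The convention on half-integral `a`: the reciprocal of `binom(2n+2a, n+a)`, and so the whole
term, is zero when `2n+2a` is a negative integer. -/
theorem aperyTerm_eq_zero (q : ℕ) (x a : ℂ) (n : ℤ) (m : ℕ)
    (h : 2 * (n : ℂ) + 2 * a = -((m : ℂ) + 1)) : aperyTerm q x a n = 0 := by
  have h' : 2 * (n : ℂ) + 2 * a + 1 = -(m : ℂ) := by rw [h]; ring
  simp [aperyTerm, genBinom, h', Complex.Gamma_neg_nat_eq_zero]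

/-- The term with index `n + 1` (for `n = 0, 1, 2, …`) of the cyclotomic Hurwitz zeta series
`Li_p(x; c) = ∑_{n ≥ 1} x^n / (n + c - 1)^p`. -/
def cycHurwitzTerm (p : ℕ) (x c : ℂ) (n : ℕ) : ℂ :=
  x ^ (n + 1) / ((n : ℂ) + c) ^ p

/-- The cyclotomic Hurwitz zeta function `Li_p(x; c)`, `(p, x) ≠ (1, 1)`; the series is summed
as the limit of its partial sums. -/
def cycHurwitz (p : ℕ) (x c : ℂ) : ℂ :=
  ∑'[conditional ℕ] n, cycHurwitzTerm p x c n

open Classical in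
/-- The linear combination `u Li_p(x⁻¹; a) + v Li_p(x; 1 - a)`. For `(p, x) = (1, 1)` the two
series diverge and the combination is read as the single series with terms combined, that is, as
the limit of the same linear combination of the partial sums. -/
def cycHurwitzComb (u v : ℂ) (p : ℕ) (x a : ℂ) : ℂ :=
  if p = 1 ∧ x = 1 then
    ∑'[conditional ℕ] n, (u * cycHurwitzTerm p x⁻¹ a n + v * cycHurwitzTerm p x (1 - a) n)
  else u * cycHurwitz p x⁻¹ a + v * cycHurwitz p x (1 - a)

/-- The term with index `n + 1` (for `n = 0, 1, 2, …`) of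
`∑_{n ≥ 1} binom(2n, n) x^n / (n^(q-1) 4^n)`. -/
def centralTerm (q : ℕ) (x : ℂ) (n : ℕ) : ℂ :=
  ((Nat.choose (2 * (n + 1)) (n + 1) : ℕ) : ℂ) * x ^ (n + 1) /
    (((n : ℂ) + 1) ^ (q - 1) * 4 ^ (n + 1))

end

/-! By Legendre duplication the `n`-th bilateral term is `x^(-n) B(s, 1/2) / s^r` with `s = n + a`,
`r = q - 1`. The binomial series of `(1 - t)^(-1/2)` gives `B(s, 1/2) = ∑ c_m / (s + m)` with `c_m =
binom(2m, m) / 4^m` (`betaSum_eq`). Exchange the sums over `n` and `m`. Partial fractions in `s`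
reduce the inner sum `∑ x^(-n) / (s^r (s + m))` to the bilateral sums `K(p) = ∑ x^(-n) / (n + a)^p`
(`shiftedLimit_eq`). The pole at `s = -m`, moved to `0` by a shift of `n`, yields `(-1)^r K(1) x^m /
m^r`, hence the product with the central binomial series. The pole at `s = 0` yields the `K(r - j)`
with weights `(-1)^j ∑ c_m / m^(j+1)`.

These weights are the Taylor coefficients at `0` of `s B(s, 1/2) = 4^s Γ(1+s)^2 / Γ(1+2s)`. Its
logarithmic derivative has zeta values as coefficients, so exponentiating turns the weights into
convolutions of `C`, `C`, `D` and powers of `log 2` (`betaTaylor_mk_eq`). Splitting `K(p)` at `n =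
0` gives the Hurwitz combinations.

For `r ≥ 1` the exchange is justified by absolute convergence
(`summable_centralRatio_mul_inv_mul_inv`). For `r = 0` that fails; since then `x ≠ 1`, the argument
is applied to `x G(n+1) - G(n)`, where `G(n)` is the term, and the sum of `G` is recovered by
summation by parts (`hasSum_zpow_mul_betaSum`). -/

noncomputable section

/-! ### Decay of the central binomial coefficients -/

/-- The normalized central binomial coefficient `binom(2m, m) / 4^m`. -/
def centralRatio (m : ℕ) : ℝ := (Nat.centralBinom m : ℝ) / 4 ^ m

theorem centralRatio_zero : centralRatio 0 = 1 := by simp [centralRatio]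

theorem centralRatio_pos (m : ℕ) : 0 < centralRatio m := by
  have := Nat.centralBinom_pos m
  unfold centralRatio; positivity

theorem centralRatio_succ (m : ℕ) :
    centralRatio (m + 1) = centralRatio m * ((m + 1 / 2) / (m + 1)) := by
  have h : ((m : ℝ) + 1) * (Nat.centralBinom (m + 1) : ℝ) =
      2 * (2 * m + 1) * Nat.centralBinom m := by
    exact_mod_cast Nat.succ_mul_centralBinom_succ m
  have hm : (m : ℝ) + 1 ≠ 0 := by positivity
  unfold centralRatio
  rw [pow_succ, div_mul_div_comm, div_eq_div_iff (by positivity) (by positivity)]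
  linear_combination (4 : ℝ) ^ m * h

theorem centralRatio_sub_succ (m : ℕ) :
    centralRatio m - centralRatio (m + 1) = centralRatio m / (2 * (m + 1)) := by
  rw [centralRatio_succ]
  have hm : (m : ℝ) + 1 ≠ 0 := by positivity
  field_simp
  ring

theorem centralRatio_antitone : Antitone centralRatio := by
  refine antitone_nat_of_succ_le fun m => ?_
  have h := centralRatio_sub_succ m
  have : 0 ≤ centralRatio m / (2 * (m + 1)) := by
    have := centralRatio_pos m; positivity
  linarith

/-- Wallis-type bound: consecutive values of the left side have ratio `(2m+1)(2m+3) / (2m+2)^2 < 1`.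
It supplies the decay `m^(-1/2)`. -/
theorem centralRatio_sq_le (m : ℕ) : centralRatio m ^ 2 * (2 * m + 1) ≤ 1 := by
  induction m with
  | zero => simp [centralRatio_zero]
  | succ m ih =>
    have hm : (0 : ℝ) < m + 1 := by positivity
    refine le_trans ?_ ih
    rw [centralRatio_succ, mul_pow, mul_assoc]
    refine mul_le_mul_of_nonneg_left ?_ (by positivity)
    rw [div_pow, div_mul_eq_mul_div, div_le_iff₀ (by positivity)]
    push_cast
    nlinarith

theorem centralRatio_le (m : ℕ) : centralRatio m ≤ ((m : ℝ) + 1) ^ (-(1 / 2) : ℝ) := by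
  rw [Real.rpow_neg (by positivity), ← Real.sqrt_eq_rpow, ← one_div, le_div_iff₀ (by positivity)]
  refine (sq_le_one_iff₀ (by have := centralRatio_pos m; positivity)).1 ?_
  rw [mul_pow, Real.sq_sqrt (by positivity)]
  have h := centralRatio_sq_le m
  have h2 : 0 ≤ centralRatio m ^ 2 * m := by positivity
  nlinarith

theorem centralRatio_tendsto : Filter.Tendsto centralRatio Filter.atTop (nhds 0) := by
  refine squeeze_zero (fun m => (centralRatio_pos m).le) centralRatio_le ?_
  exact (tendsto_rpow_neg_atTop (by norm_num : (0 : ℝ) < 1 / 2)).comp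
    (tendsto_natCast_atTop_atTop.atTop_add tendsto_const_nhds)

/-- The asymptotic bound extends to every `n` because the comparison function never vanishes; if `n
+ s = 0` the left side is `0` by convention. -/
theorem norm_inv_intCast_add_le (s : ℂ) :
    ∃ C : ℝ, 0 < C ∧ ∀ n : ℤ, ‖((n : ℂ) + s)⁻¹‖ ≤ C * (|(n : ℝ)| + 1)⁻¹ := by
  have h1 := EisensteinSeries.linear_inv_isBigO_right 1 s
  have h2 : (fun d : ℤ => ((d : ℝ))⁻¹) =O[Filter.cofinite] fun d => (|(d : ℝ)| + 1)⁻¹ := by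
    refine Asymptotics.IsBigO.of_bound 2 ?_
    filter_upwards [(Set.finite_singleton (0 : ℤ)).compl_mem_cofinite] with d hd
    have hd' : (1 : ℝ) ≤ |(d : ℝ)| := by
      exact_mod_cast Int.one_le_abs hd
    rw [norm_inv, norm_inv, Real.norm_eq_abs, Real.norm_eq_abs, abs_of_nonneg (a := |(d : ℝ)| + 1)
      (by positivity), ← div_eq_mul_inv, inv_eq_one_div, div_le_div_iff₀ (by positivity)
      (by positivity)]
    linarith
  have h3 := h1.trans h2
  rw [Asymptotics.isBigO_cofinite_iff] at h3
  · obtain ⟨C, hC⟩ := h3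
    refine ⟨max C 1, by positivity, fun n => ?_⟩
    have := hC n
    rw [Real.norm_of_nonneg (by positivity)] at this
    simp only [Int.cast_one, one_mul, add_comm s] at this
    exact this.trans (by gcongr; exact le_max_left _ _)
  · intro n hn
    have : (0 : ℝ) < (|(n : ℝ)| + 1)⁻¹ := by positivity
    exact absurd hn this.ne'

/-! ### The beta function `B(s, 1/2)` by partial fractions -/

/-- The partial fraction series `∑ binom(2m, m) / (4^m (s + m))` of the beta function
`B(s, 1/2)`. -/
def betaSum (s : ℂ) : ℂ := ∑' m : ℕ, (centralRatio m : ℂ) / (s + m)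

theorem summable_centralRatio_div_succ :
    Summable fun m : ℕ => centralRatio m / ((m : ℝ) + 1) := by
  have h : Summable fun m : ℕ => (((m + 1 : ℕ) : ℝ)) ^ (-(3 / 2) : ℝ) :=
    (summable_nat_add_iff 1).2 (Real.summable_nat_rpow.2 (by norm_num))
  refine h.of_nonneg_of_le (fun m => by have := centralRatio_pos m; positivity) fun m => ?_
  have h2 : (((m + 1 : ℕ) : ℝ)) ^ (-(3 / 2) : ℝ) = ((m : ℝ) + 1) ^ (-(1 / 2) : ℝ) / (m + 1) := by
    push_cast
    rw [show (-(3 / 2) : ℝ) = -(1 / 2) - 1 by norm_num, Real.rpow_sub_one (by positivity)]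
  rw [h2]
  gcongr
  exact centralRatio_le m

theorem summable_betaSum_norm (s : ℂ) :
    Summable fun m : ℕ => ‖(centralRatio m : ℂ) / (s + m)‖ := by
  obtain ⟨C, hC, h⟩ := norm_inv_intCast_add_le s
  refine (summable_centralRatio_div_succ.mul_left C).of_nonneg_of_le (fun _ => norm_nonneg _)
    fun m => ?_
  have := h m
  simp only [Int.cast_natCast, Nat.abs_cast] at this
  rw [div_eq_mul_inv, norm_mul, Complex.norm_real, Real.norm_of_nonneg (centralRatio_pos m).le,
    add_comm s, div_eq_mul_inv, mul_left_comm]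
  exact mul_le_mul_of_nonneg_left this (centralRatio_pos m).le

theorem summable_betaSum (s : ℂ) : Summable fun m : ℕ => (centralRatio m : ℂ) / (s + m) :=
  (summable_betaSum_norm s).of_norm

/-- The termwise difference of the two sides telescopes through `T m = c_m m / (s + m)`, which is
`0` at `m = 0` and tends to `0`. -/
theorem betaSum_recurrence {s : ℂ} (hs : ∀ m : ℕ, s ≠ -m) :
    (s + 1 / 2) * betaSum (s + 1) = s * betaSum s := by
  have hne : ∀ m : ℕ, s + m ≠ 0 := fun m h => hs m (eq_neg_of_add_eq_zero_left h)
  set T : ℕ → ℂ := fun m => centralRatio m * (m / (s + m)) with hT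
  have key : ∀ m : ℕ, (s + 1 / 2) * ((centralRatio m : ℂ) / (s + 1 + m)) -
      s * ((centralRatio m : ℂ) / (s + m)) = T m - T (m + 1) := by
    intro m
    have h1 := hne m
    have h2 : s + 1 + m ≠ 0 := by have := hne (m + 1); push_cast at this; convert this using 1; ring
    have h3 : s + ((m : ℂ) + 1) ≠ 0 := by convert h2 using 1; ring
    have h4 : (m : ℂ) + 1 ≠ 0 := by exact_mod_cast m.succ_ne_zero
    simp only [hT, centralRatio_succ]
    push_cast
    field_simp
    ring
  have hT0 : Filter.Tendsto T Filter.atTop (nhds 0) := by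
    have h1 : Filter.Tendsto (fun m : ℕ => (centralRatio m : ℂ)) Filter.atTop (nhds 0) := by
      exact_mod_cast (Complex.continuous_ofReal.tendsto 0).comp centralRatio_tendsto
    have h2 := (summable_betaSum s).tendsto_atTop_zero
    have h3 : T = fun m => (centralRatio m : ℂ) - s * ((centralRatio m : ℂ) / (s + m)) := by
      funext m; have := hne m; simp only [hT]; field_simp; ring
    rw [h3]
    simpa using h1.sub (h2.const_mul s)
  have h1 : HasSum (fun m => T m - T (m + 1)) ((s + 1 / 2) * betaSum (s + 1) - s * betaSum s) := by
    simp only [← key]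
    exact ((summable_betaSum (s + 1)).hasSum.mul_left _).sub ((summable_betaSum s).hasSum.mul_left _)
  have h2 := h1.tendsto_sum_nat
  simp only [Finset.sum_range_sub'] at h2
  have h3 : Filter.Tendsto (fun n => T 0 - T n) Filter.atTop (nhds (T 0 - 0)) :=
    tendsto_const_nhds.sub hT0
  have := tendsto_nhds_unique h2 h3
  simp only [hT, Nat.cast_zero, zero_div, mul_zero, sub_zero] at this
  exact sub_eq_zero.1 this

theorem hasSum_centralRatio_mul_pow {t : ℝ} (ht : |t| < 1) :
    HasSum (fun m => centralRatio m * t ^ m) (1 / (1 - t) ^ (1 / 2 : ℝ)) := by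
  have h := Real.one_div_one_sub_rpow_hasFPowerSeriesOnBall_zero (1 / 2)
  have hc : ∀ n : ℕ, Ring.choose ((1 : ℝ) / 2 + n - 1) n = centralRatio n := by
    intro n
    have h2 : ∀ n : ℕ, (ascPochhammer ℝ n).eval (1 / 2 : ℝ) = (n ! : ℝ) * centralRatio n := by
      intro n
      induction n with
      | zero => simp [centralRatio_zero]
      | succ n ih =>
        rw [ascPochhammer_succ_eval, ih, centralRatio_succ, Nat.factorial_succ]
        push_cast
        have : (n : ℝ) + 1 ≠ 0 := by positivity
        field_simp
        ring
    have h1 := Ring.factorial_nsmul_multichoose_eq_ascPochhammer ((1 : ℝ) / 2) n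
    rw [Polynomial.ascPochhammer_smeval_eq_eval, h2, nsmul_eq_mul] at h1
    rw [← Ring.multichoose_eq]
    exact mul_left_cancel₀ (by positivity) h1
  have := h.hasSum (y := t) (by simpa [enorm_eq_nnnorm, ← NNReal.coe_lt_coe] using ht)
  simp only [FormalMultilinearSeries.ofScalars_apply_eq, hc, zero_add, smul_eq_mul] at this
  exact this

open MeasureTheory in
-- Expand `(1 - t)^(-1/2)` in the beta integral and integrate termwise; the integrals of the norms
-- add up to the same series at the real point `s.re`.
theorem betaSum_eq_betaIntegral {s : ℂ} (hs : 0 < s.re) :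
    betaSum s = Complex.betaIntegral s (1 / 2) := by
  set F : ℕ → ℝ → ℂ := fun m t => (centralRatio m : ℂ) * (t : ℂ) ^ (s + m - 1) with hF
  have hint : ∀ m : ℕ, IntegrableOn (F m) (Set.Ioc 0 1) := fun m => by
    rw [← intervalIntegrable_iff_integrableOn_Ioc_of_le zero_le_one]
    refine (intervalIntegral.intervalIntegrable_cpow' ?_).const_mul _
    simp only [Complex.sub_re, Complex.add_re, Complex.natCast_re, Complex.one_re]
    have : (0 : ℝ) ≤ m := by positivity
    linarith
  have hval : ∀ m : ℕ, ∫ t in Set.Ioc 0 1, F m t = (centralRatio m : ℂ) / (s + m) := fun m => by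
    have hm : (0 : ℝ) ≤ m := by positivity
    rw [← intervalIntegral.integral_of_le zero_le_one, hF, intervalIntegral.integral_const_mul,
      integral_cpow (Or.inl _)]
    · have h0 : s + m ≠ 0 := fun h => by
        have := congrArg Complex.re h
        simp at this; linarith
      simp [Complex.zero_cpow h0, div_eq_mul_inv]
    · simp only [Complex.sub_re, Complex.add_re, Complex.natCast_re, Complex.one_re]
      linarith
  have hnorm : ∀ m : ℕ, ∫ t in Set.Ioc 0 1, ‖F m t‖ = centralRatio m / (s.re + m) := fun m => by
    have hm : (0 : ℝ) ≤ m := by positivity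
    have : ∀ t ∈ Set.Ioc (0 : ℝ) 1, ‖F m t‖ = centralRatio m * t ^ (s.re + m - 1) := by
      intro t ht
      rw [hF]
      simp only [norm_mul, Complex.norm_real, Real.norm_of_nonneg (centralRatio_pos m).le]
      rw [Complex.norm_cpow_eq_rpow_re_of_pos ht.1]
      simp
    rw [setIntegral_congr_fun measurableSet_Ioc this, ← intervalIntegral.integral_of_le zero_le_one,
      intervalIntegral.integral_const_mul, integral_rpow (Or.inl (by linarith))]
    have h0 : s.re + m ≠ 0 := by linarith
    simp [Real.zero_rpow h0, div_eq_mul_inv]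
  have hsum : Summable fun m : ℕ => ∫ t in Set.Ioc 0 1, ‖F m t‖ := by
    simp only [hnorm]
    refine (summable_betaSum_norm (s.re : ℂ)).congr fun m => ?_
    have hm : (0 : ℝ) ≤ m := by positivity
    have : ((centralRatio m : ℝ) : ℂ) / ((s.re : ℂ) + (m : ℂ)) =
      ((centralRatio m / (s.re + m) : ℝ) : ℂ) := by push_cast; rfl
    rw [this, Complex.norm_real, Real.norm_of_nonneg]
    exact div_nonneg (centralRatio_pos m).le (by linarith)
  have key := hasSum_integral_of_summable_integral_norm hint hsum
  simp only [hval] at key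
  rw [betaSum, key.tsum_eq, Complex.betaIntegral, intervalIntegral.integral_of_le zero_le_one,
    integral_Ioc_eq_integral_Ioo, integral_Ioc_eq_integral_Ioo]
  refine setIntegral_congr_fun measurableSet_Ioo fun t ht => ?_
  have h1 := (hasSum_centralRatio_mul_pow (t := t) (by rw [abs_of_pos ht.1]; exact ht.2)).tsum_eq
  have ht0 : (t : ℂ) ≠ 0 := by exact_mod_cast ht.1.ne'
  have h2 : ∀ m : ℕ, F m t = (t : ℂ) ^ (s - 1) * ((centralRatio m * t ^ m : ℝ) : ℂ) := fun m => by
    rw [hF]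
    simp only
    rw [show s + m - 1 = s - 1 + m by ring, Complex.cpow_add _ _ ht0, Complex.cpow_natCast]
    push_cast; ring
  simp only [h2]
  rw [tsum_mul_left, ← Complex.ofReal_tsum, h1]
  congr 1
  have h3 : (0 : ℝ) ≤ 1 - t := by linarith [ht.2]
  rw [show (1 / 2 - 1 : ℂ) = ((-(1 / 2) : ℝ) : ℂ) by push_cast; norm_num,
    show (1 - (t : ℂ)) = ((1 - t : ℝ) : ℂ) by push_cast; rfl, ← Complex.ofReal_cpow h3,
    Real.rpow_neg h3, one_div]

theorem betaSum_eq_of_re_pos {s : ℂ} (hs : 0 < s.re) :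
    betaSum s = Complex.Gamma s * (√Real.pi : ℂ) / Complex.Gamma (s + 1 / 2) := by
  have h := Complex.Gamma_mul_Gamma_eq_betaIntegral (s := s) (t := 1 / 2) hs (by norm_num)
  have h1 : Complex.Gamma (s + 1 / 2) ≠ 0 := Complex.Gamma_ne_zero_of_re_pos (by
    simp only [Complex.add_re]; norm_num; linarith)
  have h2 : Complex.Gamma (1 / 2) = (√Real.pi : ℂ) := by
    rw [Complex.Gamma_one_half_eq, Real.sqrt_eq_rpow, Complex.ofReal_cpow Real.pi_pos.le]
    push_cast; rfl
  rw [eq_div_iff h1, ← h2, h, betaSum_eq_betaIntegral hs, mul_comm]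

/-- The beta function `B(s, 1/2)` as a sum of partial fractions. -/
theorem betaSum_eq {s : ℂ} (hs : ∀ m : ℕ, s ≠ -m) :
    betaSum s = Complex.Gamma s * (√Real.pi : ℂ) / Complex.Gamma (s + 1 / 2) := by
  -- Both sides obey the same relation under `s ↦ s + 1`, so the identity spreads leftwards from `0
  -- < s.re`, one unit strip at a time.
  obtain ⟨N, hN⟩ := exists_nat_gt (-s.re)
  induction N generalizing s with
  | zero => exact betaSum_eq_of_re_pos (by simpa using hN)
  | succ N ih =>
    have hs1 : ∀ m : ℕ, s + 1 ≠ -m := fun m h => hs (m + 1) (by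
      push_cast; linear_combination h)
    have h1 := ih hs1 (by push_cast at hN; simp; linarith)
    have h0 : s ≠ 0 := by simpa using hs 0
    have h2 := betaSum_recurrence hs
    have h3 : betaSum s = (s + 1 / 2) * betaSum (s + 1) / s := by
      rw [h2, mul_div_cancel_left₀ _ h0]
    rw [h3, h1, Complex.Gamma_add_one s h0]
    -- At `s = -1/2` both sides are `0`: the left has the factor `s + 1/2`, the right divides by
    -- `Γ(0)`, which is `0` by convention.
    by_cases h4 : s + 1 / 2 = 0
    · rw [h4, Complex.Gamma_zero]
      simp
    · rw [show s + 1 + 1 / 2 = (s + 1 / 2) + 1 by ring, Complex.Gamma_add_one _ h4]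
      generalize s + 1 / 2 = u at h4 ⊢
      field_simp

theorem intCast_add_ne_zero {a : ℂ} (ha : ∀ m : ℤ, a ≠ (m : ℂ)) (n : ℤ) : (n : ℂ) + a ≠ 0 :=
  fun h => ha (-n) (by push_cast; linear_combination h)

theorem intCast_add_ne_neg_natCast {a : ℂ} (ha : ∀ m : ℤ, a ≠ (m : ℂ)) (n : ℤ) (m : ℕ) :
    (n : ℂ) + a ≠ -m :=
  fun h => ha (-m - n) (by push_cast; linear_combination h)

theorem aperyTerm_eq {a : ℂ} (ha : ∀ m : ℤ, a ≠ (m : ℂ)) (x : ℂ) (r : ℕ) (n : ℤ) :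
    aperyTerm (r + 1) x a n = x ^ (-n) * (betaSum (n + a) / ((n : ℂ) + a) ^ r) := by
  have h0 := intCast_add_ne_zero ha n
  have hs := intCast_add_ne_neg_natCast ha n
  unfold aperyTerm genBinom
  rw [betaSum_eq hs, show (2 * n + 2 * a : ℂ) = 2 * (n + a) by ring]
  generalize (n : ℂ) + a = s at h0 hs ⊢
  rw [show 2 * s - s + 1 = s + 1 by ring, Complex.Gamma_add_one s h0,
    Complex.Gamma_add_one (2 * s) (by simpa using h0)]
  have h1 := Complex.Gamma_mul_Gamma_add_half s
  have hG := Complex.Gamma_ne_zero hs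
  have h2 : (2 : ℂ) ^ (1 - 2 * s) = 2 * ((4 : ℂ) ^ s)⁻¹ := by
    have h3 := Complex.natCast_mul_natCast_cpow 2 2 s
    norm_num at h3
    rw [Complex.cpow_sub _ _ two_ne_zero, Complex.cpow_one, two_mul s,
      Complex.cpow_add _ _ two_ne_zero, h3, div_eq_mul_inv]
  have h4 : (4 : ℂ) ^ s ≠ 0 := by simp [Complex.cpow_eq_zero_iff]
  rw [h2] at h1
  have hpi : (√Real.pi : ℂ) ≠ 0 := by exact_mod_cast (Real.sqrt_pos.2 Real.pi_pos).ne'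
  -- Poles of `Γ(s + 1/2)`, met for half-integral `a`: duplication makes the conventional value of
  -- `Γ(2s)` zero as well, and both sides vanish.
  by_cases h5 : Complex.Gamma (s + 1 / 2) = 0
  · have h6 : Complex.Gamma (2 * s) = 0 := by
      rw [h5, mul_zero] at h1
      simpa [h4, hpi] using h1.symm
    rw [h5, h6]
    simp
  · have h6 : Complex.Gamma (2 * s) =
      Complex.Gamma s * Complex.Gamma (s + 1 / 2) * (4 : ℂ) ^ s / (2 * (√Real.pi : ℂ)) := by
      rw [h1]; field_simp
    rw [h6]
    generalize Complex.Gamma (s + 1 / 2) = v at h5 ⊢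
    generalize (4 : ℂ) ^ s = w at h4 ⊢
    field_simp
    ring

/-! ### Absolute convergence of the double series -/

open Filter Topology

/-- If `z ≤ y` the hypothesis forces `z ≤ 2 / M`; then split `z = z^(3/4) z^(1/4)` and bound the
last factor by `y^(1/4)`. The exponents are chosen so that, after the decay `M^(-1/2)` of `c_m`,
both `M` and `y`, `z` carry the summable exponent `5/4`. -/
theorem mul_le_of_mul_mul_le_add {M y z : ℝ} (hM : 0 < M) (hy : 0 < y) (hz : 0 < z)
    (h : M * (y * z) ≤ y + z) :
    y * z ≤ 2 * M ^ (-(3 / 4) : ℝ) * (y ^ (5 / 4 : ℝ) + z ^ (5 / 4 : ℝ)) := by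
  wlog hyz : z ≤ y generalizing y z with H
  · have := H hz hy (by rw [mul_comm z y]; linarith) (not_le.1 hyz).le
    rw [mul_comm y z]; linarith
  have h1 : z ≤ 2 / M := by
    rw [le_div_iff₀ hM]
    have : M * z * y ≤ 2 * y := by linarith
    have := le_of_mul_le_mul_right this hy
    linarith
  have h2 : z ^ (3 / 4 : ℝ) ≤ 2 * M ^ (-(3 / 4) : ℝ) := by
    calc z ^ (3 / 4 : ℝ) ≤ (2 / M) ^ (3 / 4 : ℝ) := by gcongr
      _ = 2 ^ (3 / 4 : ℝ) * M ^ (-(3 / 4) : ℝ) := by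
        rw [Real.div_rpow (by norm_num) hM.le, Real.rpow_neg hM.le, div_eq_mul_inv]
      _ ≤ 2 ^ (1 : ℝ) * M ^ (-(3 / 4) : ℝ) := by gcongr <;> norm_num
      _ = _ := by rw [Real.rpow_one]
  have h3 : z ^ (1 / 4 : ℝ) ≤ y ^ (1 / 4 : ℝ) := by gcongr
  have h4 : z = z ^ (3 / 4 : ℝ) * z ^ (1 / 4 : ℝ) := by
    rw [← Real.rpow_add hz]; norm_num
  have h5 : y ^ (5 / 4 : ℝ) = y * y ^ (1 / 4 : ℝ) := by
    rw [show (5 / 4 : ℝ) = 1 + 1 / 4 by norm_num, Real.rpow_add hy, Real.rpow_one]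
  calc y * z = y * (z ^ (3 / 4 : ℝ) * z ^ (1 / 4 : ℝ)) := by rw [← h4]
    _ ≤ y * (2 * M ^ (-(3 / 4) : ℝ) * y ^ (1 / 4 : ℝ)) := by gcongr
    _ = 2 * M ^ (-(3 / 4) : ℝ) * y ^ (5 / 4 : ℝ) := by rw [h5]; ring
    _ ≤ _ := by gcongr; have : 0 ≤ z ^ (5 / 4 : ℝ) := by positivity
                linarith

theorem summable_nat_add_one_rpow {p : ℝ} (hp : p < -1) :
    Summable fun m : ℕ => ((m : ℝ) + 1) ^ p := by
  have := (summable_nat_add_iff 1).2 (Real.summable_nat_rpow.2 hp)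
  simpa using this

theorem summable_norm_inv_rpow (a : ℂ) {p : ℝ} (hp : 1 < p) :
    Summable fun n : ℤ => ‖((n : ℂ) + a)⁻¹‖ ^ p := by
  obtain ⟨C, hC, h⟩ := norm_inv_intCast_add_le a
  have h1 : Summable fun n : ℤ => (|(n : ℝ)| + 1) ^ (-p) := by
    have h2 := summable_nat_add_one_rpow (p := -p) (by linarith)
    refine Summable.of_nat_of_neg ?_ ?_ <;> simpa using h2
  refine (h1.mul_left (C ^ p)).of_nonneg_of_le (fun n => by positivity) fun n => ?_
  calc ‖((n : ℂ) + a)⁻¹‖ ^ p ≤ (C * (|(n : ℝ)| + 1)⁻¹) ^ p := by gcongr; exact h n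
    _ = _ := by
      rw [Real.mul_rpow hC.le (by positivity), Real.inv_rpow (by positivity),
        Real.rpow_neg (by positivity)]

theorem summable_centralRatio_mul_inv_mul_inv {a : ℂ} (ha : ∀ m : ℤ, a ≠ (m : ℂ)) :
    Summable fun p : ℤ × ℕ => centralRatio p.2 *
      (‖((p.1 : ℂ) + a)⁻¹‖ * ‖((p.1 : ℂ) + a + ((p.2 : ℂ) + 1))⁻¹‖) := by
  have hA : Summable fun p : ℤ × ℕ =>
      ‖((p.1 : ℂ) + a)⁻¹‖ ^ (5 / 4 : ℝ) * ((p.2 : ℝ) + 1) ^ (-(5 / 4) : ℝ) :=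
    (summable_norm_inv_rpow a (by norm_num)).mul_of_nonneg
      (summable_nat_add_one_rpow (by norm_num)) (fun _ => by positivity) (fun _ => by positivity)
  -- The shear `n ↦ n + m + 1` turns the majorant in `y` into the one in `z`.
  let e : ℤ × ℕ ≃ ℤ × ℕ :=
    { toFun := fun p => (p.1 + (p.2 + 1), p.2)
      invFun := fun p => (p.1 - (p.2 + 1), p.2)
      left_inv := fun p => by simp
      right_inv := fun p => by simp }
  have hB := e.summable_iff.2 hA
  refine ((hA.add hB).mul_left 2).of_nonneg_of_le
    (fun p => by have := centralRatio_pos p.2; positivity) fun ⟨n, m⟩ => ?_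
  simp only [Function.comp_apply, e, Equiv.coe_fn_mk]
  have h0 := intCast_add_ne_zero ha n
  have h1 : (n : ℂ) + a + ((m : ℂ) + 1) ≠ 0 := by
    have := intCast_add_ne_zero ha (n + (m + 1))
    push_cast at this
    convert this using 1; ring
  have h2 : (((n + ((m : ℤ) + 1) : ℤ)) : ℂ) + a = (n : ℂ) + a + ((m : ℂ) + 1) := by push_cast; ring
  rw [h2]
  have hM : (0 : ℝ) < m + 1 := by positivity
  set y := ‖((n : ℂ) + a)⁻¹‖
  set z := ‖((n : ℂ) + a + ((m : ℂ) + 1))⁻¹‖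
  have hy : 0 < y := norm_pos_iff.2 (inv_ne_zero h0)
  have hz : 0 < z := norm_pos_iff.2 (inv_ne_zero h1)
  have h3 : ((m : ℝ) + 1) * (y * z) ≤ y + z := by
    have h4 : ((m : ℂ) + 1) * (((n : ℂ) + a)⁻¹ * ((n : ℂ) + a + ((m : ℂ) + 1))⁻¹) =
        ((n : ℂ) + a)⁻¹ - ((n : ℂ) + a + ((m : ℂ) + 1))⁻¹ := by
      field_simp
      ring
    have h5 : ‖((m : ℂ) + 1)‖ = (m : ℝ) + 1 := by exact_mod_cast Complex.norm_natCast (m + 1)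
    calc ((m : ℝ) + 1) * (y * z) = ‖((n : ℂ) + a)⁻¹ - ((n : ℂ) + a + ((m : ℂ) + 1))⁻¹‖ := by
          rw [← h4, norm_mul, norm_mul, h5]
      _ ≤ y + z := norm_sub_le _ _
  have h6 := mul_le_of_mul_mul_le_add hM hy hz h3
  have h7 : ((m : ℝ) + 1) ^ (-(5 / 4) : ℝ) =
      ((m : ℝ) + 1) ^ (-(1 / 2) : ℝ) * ((m : ℝ) + 1) ^ (-(3 / 4) : ℝ) := by
    rw [← Real.rpow_add hM]; norm_num
  calc centralRatio m * (y * z) ≤ ((m : ℝ) + 1) ^ (-(1 / 2) : ℝ) *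
        (2 * ((m : ℝ) + 1) ^ (-(3 / 4) : ℝ) * (y ^ (5 / 4 : ℝ) + z ^ (5 / 4 : ℝ))) := by
        gcongr
        exact centralRatio_le m
    _ = _ := by rw [h7]; ring

theorem tendsto_inv_intCast_add (a : ℂ) :
    Tendsto (fun n : ℤ => ((n : ℂ) + a)⁻¹) cofinite (𝓝 0) := by
  have h := (summable_norm_inv_rpow a (p := (2 : ℕ)) (by norm_num)).tendsto_cofinite_zero
  simp only [Real.rpow_natCast] at h
  rw [tendsto_zero_iff_norm_tendsto_zero]
  have := h.sqrt
  simpa [Real.sqrt_sq] using this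

theorem norm_zpow_eq_one {x : ℂ} (hx : ‖x‖ = 1) (n : ℤ) : ‖x ^ n‖ = 1 := by
  rw [norm_zpow, hx, one_zpow]

theorem tendsto_zpow_div_intCast_add {x : ℂ} (hx : ‖x‖ = 1) (a : ℂ) :
    Tendsto (fun n : ℤ => x ^ (-n) / ((n : ℂ) + a)) cofinite (𝓝 0) := by
  have := tendsto_inv_intCast_add a
  rw [tendsto_zero_iff_norm_tendsto_zero] at this ⊢
  simpa [norm_div, norm_zpow_eq_one hx, -norm_zpow, -zpow_neg] using this

theorem summable_zpow_div_pow {x : ℂ} (hx : ‖x‖ = 1) (a : ℂ) {p : ℕ} (hp : 2 ≤ p) :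
    Summable (fun n : ℤ => x ^ (-n) / ((n : ℂ) + a) ^ p) := by
  refine Summable.of_norm ?_
  have := summable_norm_inv_rpow a (p := (p : ℕ)) (by exact_mod_cast hp)
  refine this.congr fun n => ?_
  rw [Real.rpow_natCast, norm_div, norm_zpow_eq_one hx, norm_inv, norm_pow, inv_pow, one_div]

/-! ### Partial fractions for the bilateral sums -/

theorem HasSum.tendsto_sum_Ico_int {f : ℤ → ℂ} {S : ℂ} (h : HasSum f S) :
    Tendsto (fun N : ℕ => ∑ n ∈ Finset.Ico (-(N : ℤ)) N, f n) atTop (𝓝 S) :=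
  (hasSum_symmetricIco_int_iff).1 (h.mono_left (symmetricIco ℤ).le_atTop)

theorem sum_Ico_int_sub_of_le (f : ℤ → ℂ) {A B : ℤ} (h : A ≤ B) :
    ∑ n ∈ Finset.Ico A B, (f (n + 1) - f n) = f B - f A := by
  induction B, h using Int.leInduction with
  | base => simp
  | succ B h ih =>
    have : Finset.Ico A (B + 1) = insert B (Finset.Ico A B) := by ext; simp; lia
    rw [this, Finset.sum_insert (by simp), ih]
    ring

/-- A unit shift of the window alters the partial sum by two boundary terms, which vanish in the
limit; absolute convergence is not needed, so this covers `K 1`. -/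
theorem tendsto_sum_Ico_shift {g : ℤ → ℂ} (hg : Tendsto g cofinite (𝓝 0)) {S : ℂ}
    (h : Tendsto (fun N : ℕ => ∑ n ∈ Finset.Ico (-(N : ℤ)) N, g n) atTop (𝓝 S)) (m : ℕ) :
    Tendsto (fun N : ℕ => ∑ n ∈ Finset.Ico (-(N : ℤ)) N, g (n + m)) atTop (𝓝 S) := by
  induction m generalizing g with
  | zero => simpa using h
  | succ m ih =>
    have hinj : Function.Injective fun n : ℤ => n + 1 := add_left_injective 1
    have h1 : Tendsto (fun n : ℤ => g (n + 1)) cofinite (𝓝 0) := hg.comp hinj.tendsto_cofinite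
    have hp : Tendsto (fun N : ℕ => g (N : ℤ)) atTop (𝓝 0) := by
      rw [← Nat.cofinite_eq_atTop]
      exact hg.comp Nat.cast_injective.tendsto_cofinite
    have hn : Tendsto (fun N : ℕ => g (-(N : ℤ))) atTop (𝓝 0) := by
      rw [← Nat.cofinite_eq_atTop]
      exact hg.comp (neg_injective.comp Nat.cast_injective).tendsto_cofinite
    have h2 : Tendsto (fun N : ℕ => ∑ n ∈ Finset.Ico (-(N : ℤ)) N, g (n + 1)) atTop (𝓝 S) := by
      have h3 : ∀ N : ℕ, ∑ n ∈ Finset.Ico (-(N : ℤ)) N, g (n + 1) =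
          ∑ n ∈ Finset.Ico (-(N : ℤ)) N, g n + (g N - g (-N)) := by
        intro N
        have h4 : ∑ n ∈ Finset.Ico (-(N : ℤ)) N, (g (n + 1) - g n) = g N - g (-N) :=
          sum_Ico_int_sub_of_le g (by lia)
        rw [← h4, Finset.sum_sub_distrib]
        ring
      simp only [h3]
      simpa using h.add (hp.sub hn)
    have := ih h1 h2
    refine this.congr fun N => Finset.sum_congr rfl fun n _ => ?_
    push_cast
    rw [add_assoc]

/-- The limits of the symmetric partial sums of `∑ x^(-n) / ((n+a)^r (n+a+m))` in terms of those
of `∑ x^(-n) / (n+a)^p`. -/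
def shiftedLimit (K : ℕ → ℂ) (x : ℂ) (m : ℕ) : ℕ → ℂ
  | 0 => x ^ m * K 1
  | r + 1 => (K (r + 1) - shiftedLimit K x m r) / m

/-- Iterate `1 / (s^(r+1) (s+m)) = (1 / s^(r+1) - 1 / (s^r (s+m))) / m`; at `r = 0` the shift `n ↦ n
+ m` produces the factor `x^m`. -/
theorem tendsto_shiftedLimit {x a : ℂ} (hx : ‖x‖ = 1) (ha : ∀ m : ℤ, a ≠ (m : ℂ)) {K : ℕ → ℂ}
    (hK : ∀ p, 1 ≤ p → Tendsto (fun N : ℕ => ∑ n ∈ Finset.Ico (-(N : ℤ)) N,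
      x ^ (-n) / ((n : ℂ) + a) ^ p) atTop (𝓝 (K p))) {m : ℕ} (hm : m ≠ 0) (r : ℕ) :
    Tendsto (fun N : ℕ => ∑ n ∈ Finset.Ico (-(N : ℤ)) N,
      x ^ (-n) / (((n : ℂ) + a) ^ r * ((n : ℂ) + a + m))) atTop (𝓝 (shiftedLimit K x m r)) := by
  have hx0 : x ≠ 0 := by rintro rfl; simp at hx
  have hm' : (m : ℂ) ≠ 0 := by exact_mod_cast hm
  induction r with
  | zero =>
    have h1 := hK 1 le_rfl
    simp only [pow_one] at h1
    have h2 := (tendsto_sum_Ico_shift (tendsto_zpow_div_intCast_add hx a) h1 m).const_mul (x ^ m)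
    refine h2.congr fun N => ?_
    rw [Finset.mul_sum]
    refine Finset.sum_congr rfl fun n _ => ?_
    rw [neg_add, zpow_add₀ hx0, zpow_neg x (m : ℤ), zpow_natCast]
    push_cast
    have : x ^ m ≠ 0 := pow_ne_zero _ hx0
    rw [show (n : ℂ) + a + m = n + m + a by ring]
    field_simp
  | succ r ih =>
    have h1 := ((hK (r + 1) (by lia)).sub ih).div_const (m : ℂ)
    refine h1.congr fun N => ?_
    rw [← Finset.sum_sub_distrib, Finset.sum_div]
    refine Finset.sum_congr rfl fun n _ => ?_
    have h2 := intCast_add_ne_zero ha n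
    have h3 : (n : ℂ) + a + m ≠ 0 := fun h =>
      intCast_add_ne_neg_natCast ha n m (eq_neg_of_add_eq_zero_left h)
    generalize (n : ℂ) + a = s at h2 h3 ⊢
    field_simp
    ring

theorem shiftedLimit_eq (K : ℕ → ℂ) (x : ℂ) {m : ℕ} (hm : m ≠ 0) (r : ℕ) :
    shiftedLimit K x m r = (-1) ^ r * K 1 * (x ^ m / (m : ℂ) ^ r) +
      ∑ j ∈ Finset.range r, (-1) ^ j * K (r - j) * (1 / (m : ℂ) ^ (j + 1)) := by
  have hm' : (m : ℂ) ≠ 0 := by exact_mod_cast hm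
  induction r with
  | zero => simp [shiftedLimit, mul_comm]
  | succ r ih =>
    rw [shiftedLimit, ih, Finset.sum_range_succ', sub_div, add_div, Finset.sum_div]
    have : ∀ j ∈ Finset.range r, (-1) ^ (j + 1) * K (r + 1 - (j + 1)) * (1 / (m : ℂ) ^ (j + 1 + 1)) =
        -((-1) ^ j * K (r - j) * (1 / (m : ℂ) ^ (j + 1)) / m) := fun j _ => by
      rw [Nat.add_sub_add_right]
      field_simp
      ring
    rw [Finset.sum_congr rfl this, Finset.sum_neg_distrib]
    simp only [pow_zero, Nat.sub_zero]
    field_simp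
    ring

/-! ### Exchange of summations -/

/-- One factor `1 / (n + a)` is kept for the majorant and the other `r - 1` are bounded by a
constant. The weight `d` is general because it is `c_(m+1)` when `r ≥ 1` in the theorem, and `c_m`
in the case `q = 1`. -/
theorem summable_shifted_double {x a : ℂ} (hx : ‖x‖ = 1) (ha : ∀ m : ℤ, a ≠ (m : ℂ)) {d : ℕ → ℝ}
    (hd : ∀ m, |d m| ≤ centralRatio m) {r : ℕ} (hr : 1 ≤ r) :
    Summable fun p : ℤ × ℕ => (d p.2 : ℂ) *
      (x ^ (-p.1) / (((p.1 : ℂ) + a) ^ r * ((p.1 : ℂ) + a + ((p.2 + 1 : ℕ) : ℂ)))) := by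
  obtain ⟨C, hC, h⟩ := norm_inv_intCast_add_le a
  obtain ⟨r, rfl⟩ := Nat.exists_eq_add_of_le' hr
  refine Summable.of_norm_bounded ((summable_centralRatio_mul_inv_mul_inv ha).mul_left (C ^ r)) ?_
  rintro ⟨n, m⟩
  have h1 : ‖((n : ℂ) + a)⁻¹‖ ≤ C := (h n).trans (by
    have : (|(n : ℝ)| + 1)⁻¹ ≤ 1 := inv_le_one_of_one_le₀ (by linarith [abs_nonneg (n : ℝ)])
    nlinarith)
  have h2 : ‖((n : ℂ) + a)⁻¹‖ ^ r ≤ C ^ r := by gcongr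
  simp only [div_eq_mul_inv, norm_mul, mul_inv, norm_zpow_eq_one hx, Complex.norm_real,
    Real.norm_eq_abs, one_mul, ← inv_pow, norm_pow, pow_succ, Nat.cast_add, Nat.cast_one]
  calc |d m| * (‖((n : ℂ) + a)⁻¹‖ ^ r * ‖((n : ℂ) + a)⁻¹‖ * ‖((n : ℂ) + a + ((m : ℂ) + 1))⁻¹‖)
      ≤ centralRatio m * (C ^ r * ‖((n : ℂ) + a)⁻¹‖ * ‖((n : ℂ) + a + ((m : ℂ) + 1))⁻¹‖) := by
        gcongr
        · exact (centralRatio_pos m).le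
        · exact hd m
    _ = _ := by ring

/-- Fubini, with each inner sum over `n` identified by its symmetric partial sums. -/
theorem hasSum_tsum_of_tendsto_sum_Ico {F : ℤ → ℕ → ℂ} (hs : Summable (Function.uncurry F))
    {v : ℕ → ℂ} (hv : ∀ m, Tendsto (fun N : ℕ => ∑ n ∈ Finset.Ico (-(N : ℤ)) N, F n m) atTop
      (𝓝 (v m))) : HasSum (fun n => ∑' m, F n m) (∑' m, v m) ∧ Summable v := by
  have h1 : ∀ m, ∑' n, F n m = v m := fun m =>
    tendsto_nhds_unique (hs.prod_symm.prod_factor m).hasSum.tendsto_sum_Ico_int (hv m)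
  have h2 := hs.hasSum.prod_fiberwise fun n => (hs.prod_factor n).hasSum
  have h3 : ∑' p, Function.uncurry F p = ∑' m, v m := by
    rw [hs.tsum_prod]
    have h4 := hs.tsum_comm
    exact h4.symm.trans (tsum_congr h1)
  rw [h3] at h2
  exact ⟨h2, hs.prod_symm.prod.congr h1⟩

theorem hasSum_shifted_double {x a : ℂ} (hx : ‖x‖ = 1) (ha : ∀ m : ℤ, a ≠ (m : ℂ)) {K : ℕ → ℂ}
    (hK : ∀ p, 1 ≤ p → Tendsto (fun N : ℕ => ∑ n ∈ Finset.Ico (-(N : ℤ)) N,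
      x ^ (-n) / ((n : ℂ) + a) ^ p) atTop (𝓝 (K p))) {d : ℕ → ℝ}
    (hd : ∀ m, |d m| ≤ centralRatio m) {r : ℕ} (hr : 1 ≤ r) :
    HasSum (fun n : ℤ => ∑' m : ℕ, (d m : ℂ) *
      (x ^ (-n) / (((n : ℂ) + a) ^ r * ((n : ℂ) + a + ((m + 1 : ℕ) : ℂ)))))
      (∑' m : ℕ, (d m : ℂ) * shiftedLimit K x (m + 1) r) ∧
    Summable fun m : ℕ => (d m : ℂ) * shiftedLimit K x (m + 1) r := by
  refine hasSum_tsum_of_tendsto_sum_Ico (F := fun (n : ℤ) (m : ℕ) => (d m : ℂ) *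
      (x ^ (-n) / (((n : ℂ) + a) ^ r * ((n : ℂ) + a + ((m + 1 : ℕ) : ℂ)))))
    (summable_shifted_double hx ha hd hr) fun m => ?_
  simp only [← Finset.mul_sum]
  exact (tendsto_shiftedLimit hx ha hK m.succ_ne_zero r).const_mul (d m : ℂ)

/-- The pole `m = 0` of the beta function merges with `(n + a)^r` and gives `K (r + 1)`; the poles
`m ≥ 1` form the double series. -/
theorem hasSum_zpow_mul_betaSum_div {x a : ℂ} (hx : ‖x‖ = 1) (ha : ∀ m : ℤ, a ≠ (m : ℂ))
    {K : ℕ → ℂ} (hK : ∀ p, 1 ≤ p → Tendsto (fun N : ℕ => ∑ n ∈ Finset.Ico (-(N : ℤ)) N,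
      x ^ (-n) / ((n : ℂ) + a) ^ p) atTop (𝓝 (K p))) {r : ℕ} (hr : 1 ≤ r) :
    HasSum (fun n : ℤ => x ^ (-n) * (betaSum (n + a) / ((n : ℂ) + a) ^ r))
      (K (r + 1) + ∑' m : ℕ, (centralRatio (m + 1) : ℂ) * shiftedLimit K x (m + 1) r) := by
  have h1 := hasSum_shifted_double hx ha hK (d := fun m => centralRatio (m + 1)) (fun m => by
    rw [abs_of_pos (centralRatio_pos _)]; exact centralRatio_antitone m.le_succ) hr |>.1
  have h2 := (summable_zpow_div_pow hx a (p := r + 1) (by lia)).hasSum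
  rw [tendsto_nhds_unique h2.tendsto_sum_Ico_int (hK (r + 1) (by lia))] at h2
  refine (h2.add h1).congr_fun fun n => ?_
  have h0 := intCast_add_ne_zero ha n
  rw [betaSum, (summable_betaSum _).tsum_eq_zero_add, centralRatio_zero, add_div, mul_add,
    ← tsum_div_const, ← tsum_mul_left]
  congr 1
  · simp only [Complex.ofReal_one, Nat.cast_zero, add_zero]
    field_simp
    ring
  · refine tsum_congr fun m => ?_
    simp only [div_eq_mul_inv, mul_inv]
    ring

/-! ### The conditionally convergent case `q = 1` -/

/-- Summable differences give a limit; were it nonzero, the second hypothesis would make the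
harmonic series converge. -/
theorem tendsto_zero_of_summable_sub {u : ℕ → ℂ} (h : Summable fun n => u (n + 1) - u n)
    (h' : Summable fun n => ‖u n‖ / ((n : ℝ) + 1)) : Tendsto u atTop (𝓝 0) := by
  have h1 := h.hasSum.tendsto_sum_nat
  simp only [Finset.sum_range_sub] at h1
  set S := ∑' n, (u (n + 1) - u n)
  have h2 : Tendsto u atTop (𝓝 (S + u 0)) := by simpa using h1.add_const (u 0)
  by_cases h3 : S + u 0 = 0
  · rwa [h3] at h2
  exfalso
  have h4 : ∀ᶠ n in atTop, ‖S + u 0‖ / 2 ≤ ‖u n‖ :=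
    h2.norm.eventually_const_le (by have := norm_pos_iff.2 h3; linarith)
  have h5 : Summable fun n : ℕ => ‖S + u 0‖ / 2 * (1 / ((n : ℝ) + 1)) := by
    refine Summable.of_norm_bounded_eventually_nat h' ?_
    filter_upwards [h4] with n hn
    rw [Real.norm_of_nonneg (by positivity), ← div_eq_mul_one_div]
    gcongr
  have h6 := (summable_mul_left_iff (by have := norm_pos_iff.2 h3; positivity)).1 h5
  have h7 : Summable fun n : ℕ => 1 / (((n + 1 : ℕ)) : ℝ) := by simpa using h6
  exact Real.not_summable_one_div_natCast ((summable_nat_add_iff 1).1 h7)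

theorem betaSum_sub {s : ℂ} (hs : ∀ m : ℕ, s ≠ -m) :
    betaSum (s + 1) - betaSum s = -(1 / 2) * (betaSum (s + 1) / s) := by
  have h0 : s ≠ 0 := by simpa using hs 0
  have h := betaSum_recurrence hs
  field_simp
  linear_combination 2 * h

theorem betaSum_succ_div (x s : ℂ) (n : ℤ) : x ^ (-n) * (betaSum (s + 1) / s) =
    ∑' m : ℕ, (centralRatio m : ℂ) * (x ^ (-n) / (s ^ 1 * (s + ((m + 1 : ℕ) : ℂ)))) := by
  rw [betaSum, ← tsum_div_const, ← tsum_mul_left]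
  refine tsum_congr fun m => ?_
  rw [show s + 1 + m = s + ((m + 1 : ℕ) : ℂ) by push_cast; ring]
  simp only [div_eq_mul_inv, mul_inv]
  ring

theorem abs_centralRatio_le (m : ℕ) : |centralRatio m| ≤ centralRatio m :=
  (abs_of_pos (centralRatio_pos m)).le

theorem summable_betaSum_succ_div {a : ℂ} (ha : ∀ m : ℤ, a ≠ (m : ℂ)) :
    Summable fun n : ℤ => betaSum ((n : ℂ) + a + 1) / ((n : ℂ) + a) := by
  have h := (summable_shifted_double (x := 1) (by simp) ha abs_centralRatio_le le_rfl).prod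
  refine h.congr fun n => ?_
  have := betaSum_succ_div 1 ((n : ℂ) + a) n
  simp only [one_zpow, one_mul] at this ⊢
  exact this.symm

/-- Both hypotheses of `tendsto_zero_of_summable_sub` follow from summability of `betaSum (n + a +
1) / (n + a)`, so no asymptotics of `Γ` are needed, even as `n → -∞`. -/
theorem tendsto_betaSum_intCast_add {a : ℂ} (ha : ∀ m : ℤ, a ≠ (m : ℂ)) :
    Tendsto (fun n : ℤ => betaSum ((n : ℂ) + a)) cofinite (𝓝 0) := by
  have h1 := summable_betaSum_succ_div ha
  have hd : Summable fun n : ℤ => betaSum (((n + 1 : ℤ) : ℂ) + a) - betaSum ((n : ℂ) + a) := by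
    refine (h1.mul_left (-(1 / 2))).congr fun n => ?_
    rw [← betaSum_sub (intCast_add_ne_neg_natCast ha n)]
    push_cast
    ring_nf
  have hn : Summable fun n : ℤ => ‖betaSum ((n : ℂ) + a)‖ / (|(n : ℝ)| + 1) := by
    have h2 := (Equiv.subRight (1 : ℤ)).summable_iff.2 h1.norm
    refine (h2.mul_left (1 + ‖a‖)).of_nonneg_of_le (fun n => by positivity) fun n => ?_
    simp only [Function.comp_apply, Equiv.subRight_apply]
    have h3 := intCast_add_ne_zero ha (n - 1)
    rw [show (((n - 1 : ℤ)) : ℂ) + a + 1 = n + a by push_cast; ring, norm_div, mul_div_assoc',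
      mul_comm, div_le_div_iff₀ (by positivity) (norm_pos_iff.2 h3), mul_assoc]
    gcongr
    calc ‖((n - 1 : ℤ) : ℂ) + a‖ ≤ ‖((n - 1 : ℤ) : ℂ)‖ + ‖a‖ := norm_add_le _ _
      _ ≤ (|(n : ℝ)| + 1) + ‖a‖ := by
        gcongr
        rw [Complex.norm_intCast]
        push_cast
        exact (abs_sub _ _).trans (by simp)
      _ ≤ (1 + ‖a‖) * (|(n : ℝ)| + 1) := by
        have := mul_nonneg (norm_nonneg a) (abs_nonneg (n : ℝ)); linarith
  rw [Int.cofinite_eq, tendsto_sup]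
  have e1 : Function.Injective fun n : ℕ => -(n : ℤ) - 1 := fun m n h => by simpa using h
  have e2 : Function.Injective fun n : ℕ => -(n : ℤ) := fun m n h => by simpa using h
  constructor
  · have := tendsto_zero_of_summable_sub (u := fun n : ℕ => betaSum (((-(n : ℤ) : ℤ) : ℂ) + a))
      ((hd.comp_injective e1).neg.congr fun n => by
        simp only [Function.comp_apply]
        push_cast
        ring_nf)
      ((hn.comp_injective e2).congr fun n => by simp)
    have h2 : Tendsto (fun n : ℤ => betaSum (((-n : ℤ) : ℂ) + a)) atTop (𝓝 0) := by
      rw [← Nat.map_cast_int_atTop, tendsto_map'_iff]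
      exact this
    exact (h2.comp tendsto_neg_atBot_atTop).congr fun n => by simp
  · have := tendsto_zero_of_summable_sub (u := fun n : ℕ => betaSum (((n : ℤ) : ℂ) + a))
      ((hd.comp_injective Nat.cast_injective).congr fun n => by simp)
      ((hn.comp_injective Nat.cast_injective).congr fun n => by simp)
    rw [← Nat.map_cast_int_atTop, tendsto_map'_iff]
    exact this

/-- Summation by parts: over a window, `∑ (x G(n+1) - G(n))` is `(x - 1) ∑ G(n)` plus `x` times two
boundary values, which vanish as the two ends move independently. -/
theorem hasSum_conditional_int {G : ℤ → ℂ} {x T : ℂ} (hx1 : x ≠ 1)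
    (hG : Tendsto G cofinite (𝓝 0)) (h : HasSum (fun n => x * G (n + 1) - G n) T) :
    HasSum G (T / (x - 1)) (conditional ℤ) := by
  have hx : x - 1 ≠ 0 := sub_ne_zero.2 hx1
  have h1 := h.mono_left (conditional ℤ).le_atTop
  simp only [HasSum, conditional_filter, tendsto_map'_iff] at h1 ⊢
  rw [Int.cofinite_eq, tendsto_sup] at hG
  have hB : Tendsto (fun p : ℤ × ℤ => G (p.2 + 1)) (atBot ×ˢ atTop) (𝓝 0) :=
    hG.2.comp ((tendsto_atTop_add_const_right _ _ tendsto_id).comp tendsto_snd)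
  have hA : Tendsto (fun p : ℤ × ℤ => G p.1) (atBot ×ˢ atTop) (𝓝 0) := hG.1.comp tendsto_fst
  have h2 := (h1.sub ((hB.sub hA).const_mul x)).div_const (x - 1)
  simp only [sub_self, mul_zero, sub_zero] at h2
  refine h2.congr' ?_
  filter_upwards [prod_mem_prod (Iic_mem_atBot 0) (Ici_mem_atTop 0)] with p hp
  have hp' : p.1 ≤ p.2 + 1 := by
    have h3 : p.1 ≤ 0 := hp.1
    have h4 : 0 ≤ p.2 := hp.2
    lia
  have h3 := sum_Ico_int_sub_of_le G hp'
  have h4 : Finset.Ico p.1 (p.2 + 1) = Finset.Icc p.1 p.2 := by ext; simp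
  rw [h4, Finset.sum_sub_distrib] at h3
  simp only [Function.comp_apply, Finset.sum_sub_distrib, ← Finset.mul_sum]
  rw [div_eq_iff hx]
  linear_combination x * h3

theorem sum_centralRatio_sub_mul (x : ℂ) (M : ℕ) :
    ∑ m ∈ Finset.range M, (((centralRatio m : ℝ) : ℂ) - centralRatio (m + 1)) * (1 - x ^ (m + 1)) =
      (1 - x) * (1 + ∑ m ∈ Finset.range M, (centralRatio (m + 1) : ℂ) * x ^ (m + 1)) -
        centralRatio M * (1 - x ^ (M + 1)) := by
  induction M with
  | zero => simp [centralRatio_zero]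
  | succ M ih =>
    rw [Finset.sum_range_succ, ih, Finset.sum_range_succ]
    ring

theorem hasSum_zpow_mul_betaSum {x a : ℂ} (hx : ‖x‖ = 1) (hx1 : x ≠ 1)
    (ha : ∀ m : ℤ, a ≠ (m : ℂ))
    {K : ℕ → ℂ} (hK : ∀ p, 1 ≤ p → Tendsto (fun N : ℕ => ∑ n ∈ Finset.Ico (-(N : ℤ)) N,
      x ^ (-n) / ((n : ℂ) + a) ^ p) atTop (𝓝 (K p))) {P : ℂ}
    (hP : Tendsto (fun M : ℕ => ∑ m ∈ Finset.range M, (centralRatio (m + 1) : ℂ) * x ^ (m + 1))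
      atTop (𝓝 P)) :
    HasSum (fun n : ℤ => x ^ (-n) * betaSum (n + a)) (K 1 * (1 + P)) (conditional ℤ) := by
  have hx0 : x ≠ 0 := by rintro rfl; simp at hx
  have hG : Tendsto (fun n : ℤ => x ^ (-n) * betaSum (n + a)) cofinite (𝓝 0) := by
    have := tendsto_betaSum_intCast_add ha
    rw [tendsto_zero_iff_norm_tendsto_zero] at this ⊢
    simpa [norm_mul, norm_zpow_eq_one hx, -norm_zpow, -zpow_neg] using this
  have hD := hasSum_shifted_double hx ha hK abs_centralRatio_le le_rfl
  have hT := hD.1.mul_left (-(1 / 2))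
  -- Here `shiftedLimit K x (m+1) 1 = K 1 (1 - x^(m+1)) / (m+1)` and `c_m / (m+1) = 2 (c_m -
  -- c_(m+1))`, so Abel summation brings in `P`.
  have hlim : ∑' m : ℕ, (centralRatio m : ℂ) * shiftedLimit K x (m + 1) 1 =
      2 * K 1 * ((1 - x) * (1 + P)) := by
    have hterm : ∀ m : ℕ, (centralRatio m : ℂ) * shiftedLimit K x (m + 1) 1 =
        2 * K 1 * ((((centralRatio m : ℝ) : ℂ) - centralRatio (m + 1)) * (1 - x ^ (m + 1))) := by
      intro m
      have h1 : ((centralRatio m : ℝ) : ℂ) - centralRatio (m + 1) =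
          centralRatio m / (2 * (m + 1)) := by exact_mod_cast centralRatio_sub_succ m
      have h2 : (m : ℂ) + 1 ≠ 0 := by exact_mod_cast m.succ_ne_zero
      rw [h1]
      simp only [shiftedLimit]
      push_cast
      field_simp
    have hsum : Summable fun m : ℕ => (centralRatio m : ℂ) * shiftedLimit K x (m + 1) 1 := hD.2
    have h3 := hsum.hasSum.tendsto_sum_nat
    refine tendsto_nhds_unique h3 ?_
    simp only [hterm, ← Finset.mul_sum, sum_centralRatio_sub_mul]
    refine Tendsto.const_mul _ ?_
    have h4 : Tendsto (fun M : ℕ => (centralRatio M : ℂ) * (1 - x ^ (M + 1))) atTop (𝓝 0) := by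
      rw [tendsto_zero_iff_norm_tendsto_zero]
      refine squeeze_zero (fun _ => norm_nonneg _) (fun M => ?_)
        (by simpa using centralRatio_tendsto.mul_const 2)
      rw [norm_mul, Complex.norm_real, Real.norm_of_nonneg (centralRatio_pos M).le]
      refine mul_le_mul_of_nonneg_left ((norm_sub_le _ _).trans ?_) (centralRatio_pos M).le
      rw [norm_pow, hx]
      norm_num
    simpa using ((hP.const_add 1).const_mul (1 - x)).sub h4
  rw [hlim] at hT
  have := hasSum_conditional_int hx1 hG (T := -(1 / 2) * (2 * K 1 * ((1 - x) * (1 + P))))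
    (hT.congr_fun fun n => by
      rw [← betaSum_succ_div, mul_left_comm (-(1 / 2)), ← betaSum_sub (intCast_add_ne_neg_natCast ha n), neg_add,
        zpow_add₀ hx0, zpow_neg_one]
      push_cast
      rw [show (n : ℂ) + 1 + a = n + a + 1 by ring]
      field_simp)
  convert this using 1
  have := sub_ne_zero.2 hx1
  field_simp
  ring

/-! ### Taylor expansion of `s B(s, 1/2)` at `0` -/

/-- The function `√π Γ(s+1) / Γ(s+1/2) = 4^s / binom(2s, s)`. -/
def betaRatio (s : ℝ) : ℝ := √Real.pi * Real.Gamma (s + 1) / Real.Gamma (s + 1 / 2)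

theorem betaRatio_zero : betaRatio 0 = 1 := by
  have : √Real.pi ≠ 0 := (Real.sqrt_pos.2 Real.pi_pos).ne'
  simp only [betaRatio, zero_add, Real.Gamma_one, Real.Gamma_one_half_eq, mul_one]
  exact div_self this

theorem betaRatio_pos {s : ℝ} (hs : -(1 / 2) < s) : 0 < betaRatio s := by
  have h1 := Real.Gamma_pos_of_pos (s := s + 1) (by linarith)
  have h2 := Real.Gamma_pos_of_pos (s := s + 1 / 2) (by linarith)
  have : 0 < √Real.pi := Real.sqrt_pos.2 Real.pi_pos
  unfold betaRatio; positivity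

theorem differentiableAt_betaRatio {s : ℝ} (hs : -(1 / 2) < s) :
    DifferentiableAt ℝ betaRatio s := by
  have h2 := Real.Gamma_pos_of_pos (s := s + 1 / 2) (by linarith)
  have hd1 : DifferentiableAt ℝ Real.Gamma (s + 1) := Real.differentiableAt_Gamma fun m => by
    have : (0 : ℝ) ≤ m := by positivity
    linarith
  have hd2 : DifferentiableAt ℝ Real.Gamma (s + 1 / 2) := Real.differentiableAt_Gamma fun m => by
    have : (0 : ℝ) ≤ m := by positivity
    linarith
  have h3 := hd1.hasDerivAt.comp_add_const s 1
  have h4 := hd2.hasDerivAt.comp_add_const s (1 / 2)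
  exact (h3.differentiableAt.const_mul _).div h4.differentiableAt h2.ne'

theorem betaRatio_add_one {s : ℝ} (hs : -(1 / 2) < s) :
    (s + 1 / 2) * betaRatio (s + 1) = (s + 1) * betaRatio s := by
  have h2 := Real.Gamma_pos_of_pos (s := s + 1 / 2) (by linarith)
  have h3 : s + 1 / 2 ≠ 0 := by linarith
  have h4 : s + 1 ≠ 0 := by linarith
  unfold betaRatio
  rw [Real.Gamma_add_one h4, show s + 1 + 1 / 2 = s + 1 / 2 + 1 by ring, Real.Gamma_add_one h3]
  generalize Real.Gamma (s + 1 / 2) = u at h2 ⊢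
  generalize s + 1 / 2 = v at h3 ⊢
  field_simp

theorem betaRatio_eq_tsum {s : ℝ} (hs : -(1 / 2) < s) (hs0 : s ≠ 0) :
    betaRatio s = s * ∑' m : ℕ, centralRatio m / (s + m) := by
  have h := betaSum_eq (s := (s : ℂ)) fun m h => by
    have h1 : s = -(m : ℝ) := by exact_mod_cast h
    rcases Nat.eq_zero_or_pos m with rfl | hm
    · exact hs0 (by simpa using h1)
    · have : (1 : ℝ) ≤ m := by exact_mod_cast hm
      linarith
  have h1 : betaSum (s : ℂ) = ((∑' m : ℕ, centralRatio m / (s + m) : ℝ) : ℂ) := by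
    rw [betaSum, Complex.ofReal_tsum]
    push_cast
    rfl
  have h2 : Complex.Gamma s * (√Real.pi : ℂ) / Complex.Gamma (s + 1 / 2) =
      ((Real.Gamma s * √Real.pi / Real.Gamma (s + 1 / 2) : ℝ) : ℂ) := by
    push_cast [← Complex.Gamma_ofReal]
    rfl
  rw [h1, h2] at h
  have h3 := Complex.ofReal_injective h
  rw [h3, betaRatio, Real.Gamma_add_one hs0]
  ring

theorem summable_centralRatio_div {s : ℝ} :
    Summable fun m : ℕ => centralRatio m / (s + m) := by
  rw [← Complex.summable_ofReal]
  refine (summable_betaSum (s : ℂ)).congr fun m => ?_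
  push_cast
  rfl

/-- The Taylor coefficients of `betaRatio` at `0`. -/
def betaTaylor : ℕ → ℝ
  | 0 => 1
  | j + 1 => (-1) ^ j * ∑' m : ℕ, centralRatio (m + 1) / ((m : ℝ) + 1) ^ (j + 1)

theorem summable_centralRatio_succ_div :
    Summable fun m : ℕ => centralRatio (m + 1) / ((m : ℝ) + 1) :=
  summable_centralRatio_div_succ.of_nonneg_of_le
    (fun m => by have := centralRatio_pos (m + 1); positivity) fun m => by
    gcongr
    exact centralRatio_antitone m.le_succ

theorem summable_centralRatio_succ_div_pow (j : ℕ) :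
    Summable fun m : ℕ => centralRatio (m + 1) / ((m : ℝ) + 1) ^ (j + 1) :=
  summable_centralRatio_succ_div.of_nonneg_of_le
    (fun m => by have := centralRatio_pos (m + 1); positivity) fun m => by
    have := centralRatio_pos (m + 1)
    gcongr
    exact le_self_pow₀ (by have : (0 : ℝ) ≤ m := by positivity
                           linarith) (by lia)

/-- Expand each `s c_m / (s + m)` with `m ≥ 1` as a geometric series in `s / m`; the term `m = 0` is
the constant `1`. -/
theorem hasSum_betaTaylor {s : ℝ} (hs : |s| < 1 / 2) :
    HasSum (fun j => betaTaylor j * s ^ j) (betaRatio s) := by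
  have hs1 : |s| < 1 := by linarith
  by_cases hs0 : s = 0
  · subst hs0
    rw [betaRatio_zero]
    convert hasSum_single (f := fun j => betaTaylor j * (0 : ℝ) ^ j) 0 (fun j hj => by simp [hj])
      using 1
    simp [betaTaylor]
  set F : ℕ → ℕ → ℝ := fun j m => centralRatio (m + 1) / ((m : ℝ) + 1) * ((-s / (m + 1)) ^ j * s)
    with hF
  have hsum : Summable (Function.uncurry F) := by
    have h1 : Summable fun p : ℕ × ℕ => |s| ^ p.1 * (centralRatio (p.2 + 1) / ((p.2 : ℝ) + 1)) :=
      (summable_geometric_of_lt_one (abs_nonneg s) hs1).mul_of_nonneg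
        summable_centralRatio_succ_div (fun _ => by positivity)
        (fun m => by have := centralRatio_pos (m + 1); positivity)
    refine Summable.of_norm_bounded (h1.mul_right |s|) ?_
    rintro ⟨j, m⟩
    have := centralRatio_pos (m + 1)
    simp only [Function.uncurry, hF, norm_mul, norm_pow, norm_div, Real.norm_eq_abs, abs_neg]
    rw [abs_of_pos this, abs_of_pos (by positivity : (0 : ℝ) < m + 1)]
    have h2 : |s| / ((m : ℝ) + 1) ≤ |s| := div_le_self (abs_nonneg s) (by
      have : (0 : ℝ) ≤ m := by positivity
      linarith)
    calc centralRatio (m + 1) / ((m : ℝ) + 1) * ((|s| / (m + 1)) ^ j * |s|) ≤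
        centralRatio (m + 1) / ((m : ℝ) + 1) * (|s| ^ j * |s|) := by gcongr
      _ = _ := by ring
  have h1 : ∀ m : ℕ, ∑' j, F j m = s * (centralRatio (m + 1) / (s + (m + 1))) := fun m => by
    have hm : (0 : ℝ) < m + 1 := by positivity
    have h3 : ‖-s / ((m : ℝ) + 1)‖ < 1 := by
      rw [norm_div, norm_neg, Real.norm_eq_abs, Real.norm_of_nonneg hm.le, div_lt_one hm]
      linarith [(by positivity : (0 : ℝ) ≤ m)]
    simp only [hF]
    rw [tsum_mul_left, tsum_mul_right, tsum_geometric_of_norm_lt_one h3]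
    have h4 : s + (m + 1) ≠ 0 := by have := abs_lt.1 hs; linarith [(by positivity : (0 : ℝ) ≤ m)]
    have h5 : 1 - -s / ((m : ℝ) + 1) = (s + (m + 1)) / (m + 1) := by field_simp; ring
    rw [h5]
    field_simp
  have h2 : ∀ j : ℕ, ∑' m, F j m = betaTaylor (j + 1) * s ^ (j + 1) := fun j => by
    rw [betaTaylor, mul_assoc, ← tsum_mul_right, ← tsum_mul_left]
    refine tsum_congr fun m => ?_
    simp only [hF, div_pow, neg_pow s]
    field_simp
    ring
  have h3 := hsum.hasSum.prod_fiberwise fun j => (hsum.prod_factor j).hasSum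
  have h4 : ∑' p, Function.uncurry F p = betaRatio s - 1 := by
    rw [hsum.tsum_prod]
    have h5 := hsum.tsum_comm
    refine (h5.symm.trans (tsum_congr h1)).trans ?_
    rw [betaRatio_eq_tsum (by linarith [abs_lt.1 hs]) hs0,
      summable_centralRatio_div.tsum_eq_zero_add, tsum_mul_left]
    rw [centralRatio_zero]
    simp only [Nat.cast_zero, add_zero, Nat.cast_add, Nat.cast_one]
    field_simp
    ring
  rw [h4] at h3
  have h5 : HasSum (fun j => betaTaylor (j + 1) * s ^ (j + 1)) (betaRatio s - 1) :=
    h3.congr_fun fun j => (h2 j).symm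
  rw [← hasSum_nat_add_iff' 1]
  simpa [betaTaylor] using h5

/-! ### Logarithmic derivative and zeta values -/

theorem logDeriv_betaRatio_add_one {s : ℝ} (hs : -(1 / 2) < s) :
    logDeriv betaRatio s = 1 / (s + 1 / 2) - 1 / (s + 1) + logDeriv betaRatio (s + 1) := by
  have h1 := (differentiableAt_betaRatio hs).hasDerivAt
  have h2 := (differentiableAt_betaRatio (s := s + 1) (by linarith)).hasDerivAt
  have h3 : HasDerivAt (fun t : ℝ => (t + 1 / 2) * betaRatio (t + 1))
      (1 * betaRatio (s + 1) + (s + 1 / 2) * deriv betaRatio (s + 1)) s :=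
    ((hasDerivAt_id s).add_const _).mul (h2.comp_add_const s 1)
  have h4 : HasDerivAt (fun t : ℝ => (t + 1) * betaRatio t)
      (1 * betaRatio s + (s + 1) * deriv betaRatio s) s :=
    ((hasDerivAt_id s).add_const _).mul h1
  have h5 : (fun t : ℝ => (t + 1 / 2) * betaRatio (t + 1)) =ᶠ[𝓝 s]
      fun t : ℝ => (t + 1) * betaRatio t := by
    filter_upwards [lt_mem_nhds hs] with t ht
    exact betaRatio_add_one ht
  have h6 := (h3.congr_of_eventuallyEq h5.symm).unique h4
  have h7 := betaRatio_add_one hs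
  have h8 : s + 1 / 2 ≠ 0 := by linarith
  have h9 : s + 1 ≠ 0 := by linarith
  have h10 := (betaRatio_pos hs).ne'
  have h11 := (betaRatio_pos (s := s + 1) (by linarith)).ne'
  simp only [logDeriv_apply]
  have h12 : betaRatio (s + 1) = (s + 1) * betaRatio s / (s + 1 / 2) := by
    rw [← h7, mul_div_cancel_left₀ _ h8]
  have h13 : deriv betaRatio (s + 1) =
      (betaRatio s + (s + 1) * deriv betaRatio s - betaRatio (s + 1)) / (s + 1 / 2) := by
    rw [eq_div_iff h8]; linear_combination h6
  rw [h13, h12]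
  generalize s + 1 / 2 = v at h8 ⊢
  generalize s + 1 = w at h9 ⊢
  field_simp
  ring

/-- By the partial fractions, `betaRatio t = ∑ c_m t / (t + m)` increases while `betaRatio t / t`
decreases; the signs of the two derivatives are the two bounds. -/
theorem logDeriv_betaRatio_bounds {s : ℝ} (hs : 0 < s) :
    0 ≤ logDeriv betaRatio s ∧ logDeriv betaRatio s ≤ 1 / s := by
  have hd := differentiableAt_betaRatio (s := s) (by linarith)
  have hp := betaRatio_pos (s := s) (by linarith)
  have hmem : Set.Ioi (0 : ℝ) ∈ 𝓝 s := Ioi_mem_nhds hs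
  have heq : ∀ t : ℝ, 0 < t → betaRatio t / t = ∑' m : ℕ, centralRatio m / (t + m) := fun t ht => by
    rw [betaRatio_eq_tsum (by linarith) ht.ne', mul_div_cancel_left₀ _ ht.ne']
  have hanti : AntitoneOn (fun t => betaRatio t / t) (Set.Ioi 0) := by
    intro t ht u hu htu
    have ht' : 0 < t := ht
    simp only [heq t ht, heq u hu]
    refine summable_centralRatio_div.tsum_le_tsum (fun m => ?_) summable_centralRatio_div
    have := centralRatio_pos m
    gcongr
  have hmono : MonotoneOn betaRatio (Set.Ioi 0) := by
    intro t ht u hu htu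
    have ht' : 0 < t := ht
    have hu' : 0 < u := hu
    rw [betaRatio_eq_tsum (by linarith) ht'.ne', betaRatio_eq_tsum (by linarith) hu'.ne',
      ← tsum_mul_left, ← tsum_mul_left]
    refine (summable_centralRatio_div.mul_left _).tsum_le_tsum (fun m => ?_)
      (summable_centralRatio_div.mul_left _)
    have := centralRatio_pos m
    rw [mul_div_assoc', mul_div_assoc', div_le_div_iff₀ (by positivity) (by positivity)]
    have h1 : 0 ≤ centralRatio m * m * (u - t) := by
      have : 0 ≤ u - t := by linarith
      positivity
    linarith
  have h1 : 0 ≤ deriv betaRatio s := by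
    have := hmono.derivWithin_nonneg (x := s)
    rwa [derivWithin_of_mem_nhds hmem] at this
  have h2 : deriv (fun t => betaRatio t / t) s ≤ 0 := by
    have := hanti.derivWithin_nonpos (x := s)
    rwa [derivWithin_of_mem_nhds hmem] at this
  have h3 : HasDerivAt (fun t => betaRatio t / t) ((deriv betaRatio s * s - betaRatio s * 1) / s ^ 2) s :=
    hd.hasDerivAt.div (hasDerivAt_id s) hs.ne'
  rw [h3.deriv, div_le_iff₀ (by positivity)] at h2
  simp only [logDeriv_apply]
  refine ⟨by positivity, ?_⟩
  rw [div_le_div_iff₀ hp hs]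
  linarith

/-- Telescope the functional equation; the remainder at `s + N` lies between `0` and `1 / (s + N)`
once `s + N > 0`. -/
theorem tendsto_sum_logDeriv_betaRatio {s : ℝ} (hs : -(1 / 2) < s) :
    Tendsto (fun N : ℕ => ∑ k ∈ Finset.range N, (1 / (s + k + 1 / 2) - 1 / (s + k + 1))) atTop
      (𝓝 (logDeriv betaRatio s)) := by
  have h1 : ∀ N : ℕ, ∑ k ∈ Finset.range N, (1 / (s + k + 1 / 2) - 1 / (s + k + 1)) =
      logDeriv betaRatio s - logDeriv betaRatio (s + N) := by
    intro N
    induction N with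
    | zero => simp
    | succ N ih =>
      have := logDeriv_betaRatio_add_one (s := s + N) (by linarith [(by positivity : (0 : ℝ) ≤ N)])
      rw [Finset.sum_range_succ, ih]
      push_cast
      rw [← add_assoc]
      linarith
  have h2 : Tendsto (fun N : ℕ => s + (N : ℝ)) atTop atTop :=
    tendsto_const_nhds.add_atTop tendsto_natCast_atTop_atTop
  have h3 : Tendsto (fun N : ℕ => logDeriv betaRatio (s + N)) atTop (𝓝 0) := by
    refine squeeze_zero' ?_ ?_ ((tendsto_inv_atTop_zero.comp h2).congr fun N => rfl)
    · filter_upwards [h2.eventually_gt_atTop 0] with N hN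
      exact (logDeriv_betaRatio_bounds hN).1
    · filter_upwards [h2.eventually_gt_atTop 0] with N hN
      simpa using (logDeriv_betaRatio_bounds hN).2
  simp only [h1]
  simpa using tendsto_const_nhds.sub h3

/-- The Taylor coefficients of the logarithmic derivative of `betaRatio` at `0`. -/
def betaLogTaylor (j : ℕ) : ℝ :=
  (-1) ^ j * ∑' k : ℕ, (1 / ((k : ℝ) + 1 / 2) ^ (j + 1) - 1 / ((k : ℝ) + 1) ^ (j + 1))

/-- For `j = 0` only the difference decays quadratically; for `j ≥ 1` the subtracted term is dropped
and all but two factors `1 / (k + 1/2)` are bounded by `2`. -/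
theorem half_pow_sub_pow_bounds (k j : ℕ) :
    0 ≤ 1 / ((k : ℝ) + 1 / 2) ^ (j + 1) - 1 / ((k : ℝ) + 1) ^ (j + 1) ∧
    1 / ((k : ℝ) + 1 / 2) ^ (j + 1) - 1 / ((k : ℝ) + 1) ^ (j + 1) ≤
      2 ^ j * (1 / ((k : ℝ) + 1 / 2) ^ 2) := by
  have hk : (0 : ℝ) ≤ k := by positivity
  constructor
  · rw [sub_nonneg]
    gcongr
    norm_num
  · rcases j with _ | j
    · have h1 : 1 / ((k : ℝ) + 1 / 2) ^ (0 + 1) - 1 / ((k : ℝ) + 1) ^ (0 + 1) =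
          (1 / 2) / (((k : ℝ) + 1 / 2) * (k + 1)) := by
        field_simp; ring
      rw [h1, pow_zero, one_mul]
      rw [div_le_div_iff₀ (by positivity) (by positivity)]
      nlinarith
    · have h2 : 1 / ((k : ℝ) + 1 / 2) ≤ 2 := by
        rw [div_le_iff₀ (by positivity)]; linarith
      have h3 : 0 ≤ 1 / ((k : ℝ) + 1) ^ (j + 1 + 1) := by positivity
      calc 1 / ((k : ℝ) + 1 / 2) ^ (j + 1 + 1) - 1 / ((k : ℝ) + 1) ^ (j + 1 + 1)
          ≤ 1 / ((k : ℝ) + 1 / 2) ^ (j + 1 + 1) := by linarith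
        _ = (1 / ((k : ℝ) + 1 / 2)) ^ j * (1 / ((k : ℝ) + 1 / 2) ^ 2) := by
          rw [one_div_pow, one_div_mul_one_div, ← pow_add]
        _ ≤ 2 ^ (j + 1) * (1 / ((k : ℝ) + 1 / 2) ^ 2) := by
          gcongr
          calc (1 / ((k : ℝ) + 1 / 2)) ^ j ≤ 2 ^ j := by gcongr
            _ ≤ 2 ^ (j + 1) := by gcongr <;> norm_num

theorem summable_one_div_add_half_sq : Summable fun k : ℕ => 1 / ((k : ℝ) + 1 / 2) ^ 2 := by
  have h : Summable fun k : ℕ => 4 * (1 / (((k + 1 : ℕ) : ℝ)) ^ 2) :=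
    ((summable_nat_add_iff 1).2 (Real.summable_one_div_nat_pow.2 one_lt_two)).mul_left 4
  refine h.of_nonneg_of_le (fun k => by positivity) fun k => ?_
  have hk : (0 : ℝ) ≤ k := by positivity
  rw [mul_one_div, div_le_div_iff₀ (by positivity) (by positivity)]
  push_cast
  nlinarith

theorem hasSum_betaLogTaylor {s : ℝ} (hs : |s| < 1 / 2) :
    HasSum (fun j => betaLogTaylor j * s ^ j) (logDeriv betaRatio s) := by
  have hsl := abs_lt.1 hs
  set F : ℕ → ℕ → ℝ := fun j k =>
    (-s) ^ j * (1 / ((k : ℝ) + 1 / 2) ^ (j + 1) - 1 / ((k : ℝ) + 1) ^ (j + 1)) with hF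
  have hsum : Summable (Function.uncurry F) := by
    have h1 : Summable fun p : ℕ × ℕ => (2 * |s|) ^ p.1 * (1 / ((p.2 : ℝ) + 1 / 2) ^ 2) :=
      (summable_geometric_of_lt_one (by positivity) (by linarith)).mul_of_nonneg
        summable_one_div_add_half_sq (fun _ => by positivity) (fun _ => by positivity)
    refine Summable.of_norm_bounded h1 ?_
    rintro ⟨j, k⟩
    obtain ⟨h2, h3⟩ := half_pow_sub_pow_bounds k j
    simp only [Function.uncurry, hF, norm_mul, norm_pow, norm_neg, Real.norm_eq_abs]
    rw [abs_of_nonneg h2, mul_pow, mul_comm (2 ^ j), mul_assoc]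
    gcongr
  have h1 : ∀ k : ℕ, ∑' j, F j k = 1 / (s + k + 1 / 2) - 1 / (s + k + 1) := fun k => by
    have hk : (0 : ℝ) ≤ k := by positivity
    have hg : ∀ u : ℝ, 1 / 2 ≤ u → HasSum (fun j => (-s) ^ j * (1 / u ^ (j + 1))) (1 / (s + u)) := by
      intro u hu
      have hu0 : 0 < u := by linarith
      have h3 : ‖-s / u‖ < 1 := by
        rw [norm_div, norm_neg, Real.norm_eq_abs, Real.norm_of_nonneg hu0.le, div_lt_one hu0]
        linarith
      have h4 := (hasSum_geometric_of_norm_lt_one h3).mul_left (1 / u)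
      have h5 : s + u ≠ 0 := by linarith
      have h6 : 1 / u * (1 - -s / u)⁻¹ = 1 / (s + u) := by
        rw [show 1 - -s / u = (s + u) / u by field_simp; ring]
        field_simp
      rw [h6] at h4
      refine h4.congr_fun fun j => ?_
      rw [div_pow]
      field_simp
      ring
    have h6 := (hg (k + 1 / 2) (by linarith)).sub (hg (k + 1) (by linarith))
    simp only [hF, mul_sub]
    rw [h6.tsum_eq]
    ring
  have h2 : ∀ j : ℕ, ∑' k, F j k = betaLogTaylor j * s ^ j := fun j => by
    simp only [hF]
    rw [tsum_mul_left, betaLogTaylor, neg_pow]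
    ring
  have h3 := hsum.hasSum.prod_fiberwise fun j => (hsum.prod_factor j).hasSum
  have h4 : ∑' p, Function.uncurry F p = logDeriv betaRatio s := by
    rw [hsum.tsum_prod]
    have h5 := hsum.tsum_comm
    refine (h5.symm.trans (tsum_congr h1)).trans ?_
    have h6 : Summable fun k : ℕ => 1 / (s + k + 1 / 2) - 1 / (s + k + 1) :=
      hsum.prod_symm.prod.congr h1
    exact tendsto_nhds_unique h6.hasSum.tendsto_sum_nat
      (tendsto_sum_logDeriv_betaRatio (by linarith))
  rw [h4] at h3
  exact h3.congr_fun fun j => (h2 j).symm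

theorem betaLogTaylor_zero : betaLogTaylor 0 = 2 * Real.log 2 := by
  have h1 := (hasSum_betaLogTaylor (s := 0) (by norm_num)).unique
    (hasSum_single (f := fun j => betaLogTaylor j * (0 : ℝ) ^ j) 0 (fun j hj => by simp [hj]))
  simp only [pow_zero, mul_one] at h1
  rw [← h1, logDeriv_apply, betaRatio_zero, div_one]
  have hpi : √Real.pi ≠ 0 := (Real.sqrt_pos.2 Real.pi_pos).ne'
  have h2 : HasDerivAt (fun s : ℝ => √Real.pi * Real.Gamma (s + 1))
      (√Real.pi * -Real.eulerMascheroniConstant) 0 :=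
    (HasDerivAt.comp_add_const 0 1 (by simpa using Real.hasDerivAt_Gamma_one)).const_mul _
  have h3 : HasDerivAt (fun s : ℝ => Real.Gamma (s + 1 / 2))
      (-√Real.pi * (Real.eulerMascheroniConstant + 2 * Real.log 2)) 0 :=
    HasDerivAt.comp_add_const 0 (1 / 2) (by simpa using Real.hasDerivAt_Gamma_one_half)
  have h4 := h2.div h3 (by simp only [zero_add, Real.Gamma_one_half_eq]; exact hpi)
  have h5 : deriv betaRatio 0 = _ := h4.deriv
  rw [h5]
  simp only [zero_add, Real.Gamma_one, Real.Gamma_one_half_eq]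
  field_simp
  ring

/-- The half-integer sum is `2^p` times the sum over odd integers, that is `(2^p - 1) ζ(p)` with `p
= j + 2`; subtracting `ζ(p)` leaves `2^p - 2`. -/
theorem betaLogTaylor_succ (j : ℕ) : (betaLogTaylor (j + 1) : ℂ) =
    (-1) ^ (j + 1) * (2 ^ (j + 2) - 2) * riemannZeta ((j + 2 : ℕ) : ℂ) := by
  have hZ : riemannZeta ((j + 2 : ℕ) : ℂ) =
      ((∑' n : ℕ, 1 / ((n : ℝ) + 1) ^ (j + 2) : ℝ) : ℂ) := by
    have h1 := (Real.summable_one_div_nat_pow.2 (by lia : 1 < j + 2)).tsum_eq_zero_add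
    have h2 : (∑' n : ℕ, 1 / ((n : ℝ) + 1) ^ (j + 2)) = ∑' n : ℕ, 1 / (n : ℝ) ^ (j + 2) := by
      rw [h1]
      simp
    rw [zeta_nat_eq_tsum_of_gt_one (by lia), h2, Complex.ofReal_tsum]
    refine tsum_congr fun n => ?_
    push_cast
    rfl
  have hs0 : Summable fun n : ℕ => 1 / ((n : ℝ) + 1) ^ (j + 2) := by
    have := (summable_nat_add_iff 1).2 (Real.summable_one_div_nat_pow.2 (by lia : 1 < j + 2))
    simpa using this
  have e1 : Function.Injective fun k : ℕ => 2 * k := fun a b h => by simpa using h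
  have e2 : Function.Injective fun k : ℕ => 2 * k + 1 := fun a b h => by simpa using h
  have he : Summable fun k : ℕ => 1 / (((2 * k : ℕ) : ℝ) + 1) ^ (j + 2) := hs0.comp_injective e1
  have ho : Summable fun k : ℕ => 1 / (((2 * k + 1 : ℕ) : ℝ) + 1) ^ (j + 2) :=
    hs0.comp_injective e2
  have hsplit := tsum_even_add_odd (f := fun n : ℕ => 1 / ((n : ℝ) + 1) ^ (j + 2)) he ho
  set Z := ∑' n : ℕ, 1 / ((n : ℝ) + 1) ^ (j + 2)
  have ho' : ∑' k : ℕ, 1 / (((2 * k + 1 : ℕ) : ℝ) + 1) ^ (j + 2) = Z / 2 ^ (j + 2) := by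
    rw [← tsum_div_const]
    refine tsum_congr fun k => ?_
    push_cast
    rw [show (2 * (k : ℝ) + 1 + 1) = (k + 1) * 2 by ring, mul_pow, div_div]
  have hhalf : ∀ k : ℕ, 1 / ((k : ℝ) + 1 / 2) ^ (j + 2) =
      2 ^ (j + 2) * (1 / (((2 * k : ℕ) : ℝ) + 1) ^ (j + 2)) := fun k => by
    push_cast
    rw [show (k : ℝ) + 1 / 2 = (2 * k + 1) / 2 by ring, div_pow, one_div_div, mul_one_div]
  have hfin : ∑' k : ℕ, (1 / ((k : ℝ) + 1 / 2) ^ (j + 2) - 1 / ((k : ℝ) + 1) ^ (j + 2)) =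
      (2 ^ (j + 2) - 2) * Z := by
    simp only [hhalf]
    rw [(he.mul_left _).tsum_sub hs0, tsum_mul_left]
    rw [ho'] at hsplit
    have h2 : (2 : ℝ) ^ (j + 2) ≠ 0 := by positivity
    have h3 : ∑' k : ℕ, 1 / (((2 * k : ℕ) : ℝ) + 1) ^ (j + 2) = Z - Z / 2 ^ (j + 2) := by
      linarith
    rw [h3]
    change 2 ^ (j + 2) * (Z - Z / 2 ^ (j + 2)) - Z = _
    field_simp
    ring
  rw [betaLogTaylor, hZ, hfin]
  push_cast
  ring

/-- Compare power series coefficients in `f' = f · (f' / f)`, using uniqueness of the expansion. -/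
theorem betaTaylor_recurrence (k : ℕ) : ((k : ℝ) + 1) * betaTaylor (k + 1) =
    ∑ p ∈ Finset.HasAntidiagonal.antidiagonal k, betaTaylor p.1 * betaLogTaylor p.2 := by
  set p : FormalMultilinearSeries ℝ ℝ ℝ := .ofScalars ℝ betaTaylor with hp
  have hev : ∀ᶠ s : ℝ in 𝓝 0, |s| < 1 / 2 := by
    have := Metric.ball_mem_nhds (0 : ℝ) (by norm_num : (0 : ℝ) < 1 / 2)
    filter_upwards [this] with s hs
    simpa using hs
  have h1 : HasFPowerSeriesAt betaRatio p 0 := by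
    rw [hasFPowerSeriesAt_iff']
    filter_upwards [hev] with s hs
    simpa [hp, mul_comm] using hasSum_betaTaylor hs
  set c : ℕ → ℝ := fun n => ∑ p ∈ Finset.HasAntidiagonal.antidiagonal n, betaTaylor p.1 * betaLogTaylor p.2 with hc
  have h2 : HasFPowerSeriesAt (deriv betaRatio) (.ofScalars ℝ c) 0 := by
    rw [hasFPowerSeriesAt_iff']
    filter_upwards [hev] with s hs
    have h3 := hasSum_betaTaylor hs
    have h4 := hasSum_betaLogTaylor hs
    have h5 := (summable_norm_sum_mul_antidiagonal_of_summable_norm h3.summable.norm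
      h4.summable.norm).of_norm.hasSum
    rw [← tsum_mul_tsum_eq_tsum_sum_antidiagonal_of_summable_norm h3.summable.norm
      h4.summable.norm, h3.tsum_eq, h4.tsum_eq] at h5
    have h6 : deriv betaRatio s = betaRatio s * logDeriv betaRatio s := by
      rw [logDeriv_apply, mul_div_cancel₀]
      exact (betaRatio_pos (by linarith [abs_lt.1 hs])).ne'
    rw [h6]
    refine h5.congr_fun fun n => ?_
    simp only [hc, sub_zero, FormalMultilinearSeries.coeff_ofScalars, smul_eq_mul, Finset.mul_sum]
    refine Finset.sum_congr rfl fun q hq => ?_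
    rw [← Finset.HasAntidiagonal.mem_antidiagonal.1 hq, pow_add]
    ring
  obtain ⟨r, h7⟩ := h1
  have h8 : HasFPowerSeriesAt (deriv betaRatio)
      ((ContinuousLinearMap.apply ℝ ℝ (1 : ℝ)).compFormalMultilinearSeries p.derivSeries) 0 :=
    ((ContinuousLinearMap.apply ℝ ℝ (1 : ℝ)).comp_hasFPowerSeriesOnBall h7.fderiv).hasFPowerSeriesAt
  have h9 := congrArg (fun q => FormalMultilinearSeries.coeff q k) (h8.eq_formalMultilinearSeries h2)
  have h10 := p.derivSeries_coeff_one k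
  simp only [FormalMultilinearSeries.coeff_ofScalars, hp] at h9 h10
  change _ = c k
  rw [← h9]
  refine Eq.trans ?_ h10.symm
  simp

/-! ### Bell polynomials and the exponential formula -/

theorem PowerSeries.eq_of_derivative_eq_mul {F G L : PowerSeries ℂ}
    (hF : PowerSeries.derivative ℂ F = F * L) (hG : PowerSeries.derivative ℂ G = G * L)
    (h0 : PowerSeries.coeff 0 F = PowerSeries.coeff 0 G) : F = G := by
  ext n
  induction n using Nat.strong_induction_on with
  | _ n ih =>
    rcases n with _ | n
    · exact h0
    · have h1 := congrArg (PowerSeries.coeff n) hF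
      have h2 := congrArg (PowerSeries.coeff n) hG
      rw [PowerSeries.coeff_derivative, PowerSeries.coeff_mul] at h1 h2
      have h3 : (n : ℂ) + 1 ≠ 0 := by exact_mod_cast n.succ_ne_zero
      refine mul_right_cancel₀ h3 ?_
      rw [h1, h2]
      refine Finset.sum_congr rfl fun p hp => ?_
      rw [ih p.1 (by have := Finset.HasAntidiagonal.mem_antidiagonal.1 hp; lia)]

theorem PowerSeries.derivative_rescale (c : ℂ) (F : PowerSeries ℂ) :
    PowerSeries.derivative ℂ (PowerSeries.rescale c F) =
      PowerSeries.C c * PowerSeries.rescale c (PowerSeries.derivative ℂ F) := by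
  ext n
  rw [PowerSeries.coeff_derivative, PowerSeries.coeff_rescale, PowerSeries.coeff_C_mul,
    PowerSeries.coeff_rescale, PowerSeries.coeff_derivative]
  ring

/-- The exponential generating series of the complete Bell polynomials. -/
def bellSeries (x : ℕ → ℂ) : PowerSeries ℂ := (PowerSeries.exp ℂ).subst (bellExponent x)

theorem coeff_bellSeries (x : ℕ → ℂ) (n : ℕ) :
    PowerSeries.coeff n (bellSeries x) = completeBell n x / (n ! : ℂ) := by
  rw [completeBell, mul_div_cancel_left₀ _ (by exact_mod_cast n.factorial_ne_zero), bellSeries]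

theorem derivative_bellSeries (x : ℕ → ℂ) : PowerSeries.derivative ℂ (bellSeries x) =
    bellSeries x * PowerSeries.derivative ℂ (bellExponent x) := by
  rw [bellSeries, PowerSeries.derivative_subst (hasSubst_bellExponent x),
    PowerSeries.derivative_exp]

theorem coeff_zero_bellSeries (x : ℕ → ℂ) : PowerSeries.coeff 0 (bellSeries x) = 1 := by
  have h0 : PowerSeries.constantCoeff (bellExponent x) = 0 := by
    rw [← PowerSeries.coeff_zero_eq_constantCoeff_apply]; simp [bellExponent]
  have h1 := PowerSeries.constantCoeff_subst_eq_zero h0 (PowerSeries.exp ℂ - 1) (by simp)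
  rw [PowerSeries.subst_sub (hasSubst_bellExponent x)] at h1
  have h2 : (1 : PowerSeries ℂ).subst (bellExponent x) = 1 := by
    rw [← PowerSeries.coe_substAlgHom (hasSubst_bellExponent x), map_one]
  rw [h2, map_sub, sub_eq_zero, map_one] at h1
  rw [PowerSeries.coeff_zero_eq_constantCoeff_apply]
  exact h1

/-- The arguments of the Bell polynomials that define `bellC`. -/
def bellCArg (k : ℕ) : ℂ := if k = 1 then 0 else (-1) ^ k * ((k - 1)! : ℂ) * riemannZeta (k : ℂ)

/-- The arguments of the Bell polynomials that define `bellD`. -/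
def bellDArg (k : ℕ) : ℂ :=
  if k = 1 then 0 else (-1) ^ (k - 1) * ((k - 1)! : ℂ) * riemannZeta (k : ℂ)

/-- Formal version of `4^s Γ(1+s)^2 / Γ(1+2s)`: the series for `C` and `D` are those of `e^(γt)
Γ(1+t)` and its inverse, and the factors with `γ` cancel. Both sides have the same logarithmic
derivative and constant term `1`. -/
theorem betaTaylor_mk_eq : PowerSeries.mk (fun n => (betaTaylor n : ℂ)) =
    bellSeries bellCArg * bellSeries bellCArg * PowerSeries.rescale 2 (bellSeries bellDArg) *
      PowerSeries.rescale (2 * (Real.log 2 : ℂ)) (PowerSeries.exp ℂ) := by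
  refine PowerSeries.eq_of_derivative_eq_mul (L := PowerSeries.mk fun n => (betaLogTaylor n : ℂ))
    ?_ ?_ ?_
  · ext n
    rw [PowerSeries.coeff_derivative, PowerSeries.coeff_mul]
    simp only [PowerSeries.coeff_mk]
    rw [mul_comm]
    exact_mod_cast betaTaylor_recurrence n
  · have hL : PowerSeries.mk (fun n => (betaLogTaylor n : ℂ)) =
        2 * PowerSeries.derivative ℂ (bellExponent bellCArg) +
        PowerSeries.C 2 * PowerSeries.rescale 2 (PowerSeries.derivative ℂ (bellExponent bellDArg)) +
        PowerSeries.C (2 * (Real.log 2 : ℂ)) := by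
      ext n
      rw [show (2 : PowerSeries ℂ) = PowerSeries.C 2 from (map_ofNat _ 2).symm]
      simp only [map_add, PowerSeries.coeff_C_mul, PowerSeries.coeff_rescale,
        PowerSeries.coeff_derivative, PowerSeries.coeff_mk, PowerSeries.coeff_C, bellExponent]
      rcases n with _ | n
      · simp [betaLogTaylor_zero, bellCArg, bellDArg]
      · rw [betaLogTaylor_succ]
        simp only [bellCArg, bellDArg, Nat.add_eq_zero_iff, one_ne_zero, and_false, if_false]
        have h1 : n + 1 + 1 ≠ 1 := by lia
        have h2 : ((n + 1) ! : ℂ) ≠ 0 := by exact_mod_cast (n + 1).factorial_ne_zero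
        have h3 : (n : ℂ) + 1 + 1 ≠ 0 := by exact_mod_cast (n + 1).succ_ne_zero
        simp only [if_neg h1, Nat.add_sub_cancel, Nat.factorial_succ (n + 1)]
        push_cast
        field_simp
        ring_nf
    rw [hL]
    simp only [Derivation.leibniz, smul_eq_mul, PowerSeries.derivative_rescale,
      derivative_bellSeries, PowerSeries.derivative_exp, map_mul]
    ring
  · rw [PowerSeries.coeff_mk, PowerSeries.coeff_zero_eq_constantCoeff_apply]
    simp only [map_mul]
    simp only [← PowerSeries.coeff_zero_eq_constantCoeff_apply, PowerSeries.coeff_rescale,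
      coeff_zero_bellSeries, PowerSeries.coeff_exp, betaTaylor]
    simp

theorem sum_antidiagonalTuple_five (f g h k l : ℕ → ℂ) (n : ℕ) :
    ∑ t ∈ Finset.Nat.antidiagonalTuple 5 n, f (t 0) * g (t 1) * h (t 2) * k (t 3) * l (t 4) =
      PowerSeries.coeff n (PowerSeries.mk f * PowerSeries.mk g * PowerSeries.mk h *
        PowerSeries.mk k * PowerSeries.mk l) := by
  have h1 := PowerSeries.coeff_prod (R := ℂ)
    (fun i : Fin 5 => PowerSeries.mk (![f, g, h, k, l] i)) n Finset.univ
  simp only [Fin.prod_univ_five, Matrix.cons_val] at h1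
  rw [h1]
  refine Finset.sum_nbij' (fun t => Finsupp.equivFunOnFinite.symm t) (fun t => ⇑t) ?_ ?_ ?_ ?_ ?_
  · intro t ht
    rw [Finset.Nat.mem_antidiagonalTuple] at ht
    simp [ht]
  · intro t ht
    rw [Finset.mem_finsuppAntidiag] at ht
    rw [Finset.Nat.mem_antidiagonalTuple]
    exact ht.1
  · intro t _
    rfl
  · intro t _
    ext
    rfl
  · intro t _
    simp

theorem sum_bell_eq (R : ℕ → ℂ) (n : ℕ) :
    ∑ k ∈ Finset.Nat.antidiagonalTuple 5 n,
      bellC (k 0) * bellC (k 1) * bellD (k 2) * 2 ^ (k 2 + k 3)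
        / (((k 0)! : ℂ) * ((k 1)! : ℂ) * ((k 2)! : ℂ) * ((k 3)! : ℂ))
        * (Real.log 2 : ℂ) ^ (k 3) * R (k 4) =
    ∑ j ∈ Finset.range (n + 1), (betaTaylor j : ℂ) * R (n - j) := by
  have h1 := sum_antidiagonalTuple_five
    (fun k => PowerSeries.coeff k (bellSeries bellCArg))
    (fun k => PowerSeries.coeff k (bellSeries bellCArg))
    (fun k => PowerSeries.coeff k (PowerSeries.rescale 2 (bellSeries bellDArg)))
    (fun k => PowerSeries.coeff k
      (PowerSeries.rescale (2 * (Real.log 2 : ℂ)) (PowerSeries.exp ℂ))) R n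
  have h2 : ∀ F : PowerSeries ℂ, PowerSeries.mk (fun k => PowerSeries.coeff k F) = F :=
    fun F => by ext; simp
  rw [h2, h2, h2, ← betaTaylor_mk_eq, PowerSeries.coeff_mul,
    Finset.Nat.sum_antidiagonal_eq_sum_range_succ_mk] at h1
  simp only [PowerSeries.coeff_mk] at h1
  rw [← h1]
  refine Finset.sum_congr rfl fun k _ => ?_
  simp only [PowerSeries.coeff_rescale, coeff_bellSeries, PowerSeries.coeff_exp]
  rw [show completeBell (k 0) bellCArg = bellC (k 0) from rfl,
    show completeBell (k 1) bellCArg = bellC (k 1) from rfl,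
    show completeBell (k 2) bellDArg = bellD (k 2) from rfl, mul_pow, pow_add]
  have hf : ∀ n : ℕ, (n ! : ℂ) ≠ 0 := fun n => by exact_mod_cast n.factorial_ne_zero
  simp only [map_div₀, map_one, map_natCast]
  have h3 := hf (k 0)
  have h4 := hf (k 1)
  have h5 := hf (k 2)
  have h6 := hf (k 3)
  field_simp

/-! ### Cyclotomic Hurwitz series and bilateral sums -/

theorem hasSum_conditional_nat_iff {f : ℕ → ℂ} {S : ℂ} : HasSum f S (conditional ℕ) ↔
    Tendsto (fun N => ∑ n ∈ Finset.range N, f n) atTop (𝓝 S) := by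
  simp only [HasSum, conditional_filter_eq_map_range, tendsto_map'_iff]
  rfl

theorem summable_conditional_mul_pow {x : ℂ} (hx : ‖x‖ = 1) (hx1 : x ≠ 1) {b : ℕ → ℝ}
    (hb : Antitone b) (hb0 : Tendsto b atTop (𝓝 0)) :
    Summable (fun m => (b m : ℂ) * x ^ (m + 1)) (conditional ℕ) := by
  have hsub : 0 < ‖x - 1‖ := norm_pos_iff.2 (sub_ne_zero.2 hx1)
  have hbound : ∀ n, ‖∑ i ∈ Finset.range n, x ^ (i + 1)‖ ≤ 2 / ‖x - 1‖ := fun n => by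
    simp only [pow_succ]
    rw [← Finset.sum_mul, geom_sum_eq hx1, norm_mul, hx, mul_one, norm_div]
    gcongr
    refine (norm_sub_le _ _).trans ?_
    rw [norm_pow, hx]
    norm_num
  obtain ⟨S, hS⟩ := cauchySeq_tendsto_of_complete
    (hb.cauchySeq_series_mul_of_tendsto_zero_of_bounded hb0 hbound)
  refine ⟨S, hasSum_conditional_nat_iff.2 ?_⟩
  simpa only [Complex.real_smul] using hS

theorem summable_pow_mul_one_div_sub {x c : ℂ} (hx : ‖x‖ = 1) (hc : ∀ m : ℤ, c ≠ (m : ℂ)) :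
    Summable fun n : ℕ => x ^ (n + 1) * (1 / ((n : ℂ) + c) - 1 / ((n : ℂ) + 1)) := by
  obtain ⟨C, hC, h⟩ := norm_inv_intCast_add_le c
  have h1 : Summable fun n : ℕ => ‖1 - c‖ * C * (1 / ((n + 1 : ℕ) : ℝ) ^ 2) :=
    ((summable_nat_add_iff 1).2 (Real.summable_one_div_nat_pow.2 one_lt_two)).mul_left _
  refine Summable.of_norm_bounded h1 fun n => ?_
  have h2 := h n
  simp only [Int.cast_natCast, Nat.abs_cast] at h2
  have h3 : (n : ℂ) + c ≠ 0 := by exact_mod_cast intCast_add_ne_zero hc n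
  have h4 : (n : ℂ) + 1 ≠ 0 := by exact_mod_cast n.succ_ne_zero
  have h5 : 1 / ((n : ℂ) + c) - 1 / ((n : ℂ) + 1) = (1 - c) * ((n : ℂ) + c)⁻¹ * ((n : ℂ) + 1)⁻¹ := by
    field_simp
    ring
  have h6 : ‖(n : ℂ) + 1‖ = (n : ℝ) + 1 := by exact_mod_cast Complex.norm_natCast (n + 1)
  rw [norm_mul, norm_pow, hx, one_pow, one_mul, h5, norm_mul, norm_mul, norm_inv (_ + 1), h6]
  push_cast
  calc ‖1 - c‖ * ‖((n : ℂ) + c)⁻¹‖ * ((n : ℝ) + 1)⁻¹ ≤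
        ‖1 - c‖ * (C * ((n : ℝ) + 1)⁻¹) * ((n : ℝ) + 1)⁻¹ := by gcongr
    _ = _ := by field_simp

theorem summable_cycHurwitzTerm {x c : ℂ} (hx : ‖x‖ = 1) (hc : ∀ m : ℤ, c ≠ (m : ℂ)) {p : ℕ}
    (hp : 1 ≤ p) (hpx : ¬ (p = 1 ∧ x = 1)) : Summable (cycHurwitzTerm p x c) (conditional ℕ) := by
  rcases hp.lt_or_eq with hp | rfl
  · refine Summable.mono_filter ?_ (conditional ℕ).le_atTop
    have h1 := (summable_norm_inv_rpow c (p := (p : ℝ)) (by exact_mod_cast hp)).comp_injective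
      (Nat.cast_injective (R := ℤ))
    refine Summable.of_norm (h1.congr fun n => ?_)
    simp [cycHurwitzTerm, hx]
  · have hx1 : x ≠ 1 := fun h => hpx ⟨rfl, h⟩
    -- Dirichlet's test needs real monotone coefficients, so `1 / (n + c)` is compared with `1 / (n
    -- + 1)`; the difference is absolutely summable.
    have h1 := summable_conditional_mul_pow hx hx1 (b := fun n => 1 / ((n : ℝ) + 1))
      (fun m n hmn => by
        have : (m : ℝ) ≤ n := by exact_mod_cast hmn
        simp only
        gcongr) tendsto_one_div_add_atTop_nhds_zero_nat
    have h2 := (summable_pow_mul_one_div_sub hx hc).mono_filter (conditional ℕ).le_atTop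
    refine (h1.add h2).congr fun n => ?_
    rw [cycHurwitzTerm]
    push_cast
    ring

theorem ne_intCast_one_sub {a : ℂ} (ha : ∀ m : ℤ, a ≠ (m : ℂ)) (m : ℤ) : 1 - a ≠ (m : ℂ) :=
  fun h => ha (1 - m) (by push_cast; linear_combination -h)

/-- When both series diverge, `u + v = 0` cancels their common harmonic part. -/
theorem hasSum_cycHurwitzComb {x a : ℂ} (hx : ‖x‖ = 1) (ha : ∀ m : ℤ, a ≠ (m : ℂ)) {u v : ℂ}
    {p : ℕ} (hp : 1 ≤ p) (huv : p = 1 → x = 1 → u + v = 0) :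
    HasSum (fun n => u * cycHurwitzTerm p x⁻¹ a n + v * cycHurwitzTerm p x (1 - a) n)
      (cycHurwitzComb u v p x a) (conditional ℕ) := by
  unfold cycHurwitzComb
  split_ifs with h
  · obtain ⟨rfl, rfl⟩ := h
    have h1 := summable_pow_mul_one_div_sub (x := 1) (by simp) ha
    have h2 := summable_pow_mul_one_div_sub (x := 1) (by simp) (ne_intCast_one_sub ha)
    have h3 := ((h1.mul_left u).add (h2.mul_left v)).mono_filter (conditional ℕ).le_atTop
    refine Summable.hasSum (h3.congr fun n => ?_)
    simp only [cycHurwitzTerm, inv_one, one_pow, pow_one]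
    linear_combination (-1 / ((n : ℂ) + 1)) * huv rfl rfl
  · have hx' : ‖x⁻¹‖ = 1 := by rw [norm_inv, hx, inv_one]
    have h1 := summable_cycHurwitzTerm hx' ha hp (by simpa using h)
    have h2 := summable_cycHurwitzTerm hx (ne_intCast_one_sub ha) hp h
    exact (h1.hasSum.mul_left u).add (h2.hasSum.mul_left v)

/-- Indices `n ≥ 0` give the series at `x⁻¹`; for `n = -(k+1)`, `n + a = -(k + (1 - a))` gives the
series at `x` with sign `(-1)^p`. -/
theorem sum_Ico_zpow_div_eq {x : ℂ} (hx0 : x ≠ 0) (a : ℂ) {p : ℕ} (hp : 1 ≤ p) (N : ℕ) :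
    ∑ n ∈ Finset.Ico (-(N : ℤ)) N, x ^ (-n) / ((n : ℂ) + a) ^ p =
      ∑ n ∈ Finset.range N, (x * cycHurwitzTerm p x⁻¹ a n +
        -(-1) ^ (p - 1) * cycHurwitzTerm p x (1 - a) n) := by
  induction N with
  | zero => simp
  | succ N ih =>
    have h1 : Finset.Ico (-((N + 1 : ℕ) : ℤ)) ((N + 1 : ℕ) : ℤ) =
        insert (-((N : ℤ) + 1)) (insert (N : ℤ) (Finset.Ico (-(N : ℤ)) N)) := by
      ext n
      simp only [Finset.mem_Ico, Finset.mem_insert]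
      lia
    rw [h1, Finset.sum_insert (by simp), Finset.sum_insert (by simp), ih,
      Finset.sum_range_succ]
    have h2 : x ^ (-(N : ℤ)) / (((N : ℤ) : ℂ) + a) ^ p = x * cycHurwitzTerm p x⁻¹ a N := by
      rw [cycHurwitzTerm, zpow_neg, zpow_natCast, inv_pow, pow_succ]
      push_cast
      field_simp
    have h3 : x ^ (-(-((N : ℤ) + 1))) / (((-((N : ℤ) + 1) : ℤ) : ℂ) + a) ^ p =
        -(-1) ^ (p - 1) * cycHurwitzTerm p x (1 - a) N := by
      obtain ⟨p, rfl⟩ := Nat.exists_eq_add_of_le' hp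
      rw [cycHurwitzTerm, neg_neg, show ((N : ℤ) + 1) = ((N + 1 : ℕ) : ℤ) by push_cast; rfl,
        zpow_natCast, Nat.add_sub_cancel]
      push_cast
      rw [show -((N : ℂ) + 1) + a = -1 * (N + (1 - a)) by ring, mul_pow, pow_succ (-1 : ℂ) p]
      rcases neg_one_pow_eq_or ℂ p with h | h <;> rw [h] <;> simp [div_neg]
    rw [h2, h3]
    ring

/-- The bilateral sum `∑ x^(-n) / (n+a)^p`. -/
def bilateralSum (x a : ℂ) (p : ℕ) : ℂ := cycHurwitzComb x (-(-1) ^ (p - 1)) p x a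

theorem tendsto_bilateralSum {x a : ℂ} (hx : ‖x‖ = 1) (ha : ∀ m : ℤ, a ≠ (m : ℂ)) (p : ℕ)
    (hp : 1 ≤ p) : Tendsto (fun N : ℕ => ∑ n ∈ Finset.Ico (-(N : ℤ)) N,
      x ^ (-n) / ((n : ℂ) + a) ^ p) atTop (𝓝 (bilateralSum x a p)) := by
  have hx0 : x ≠ 0 := by rintro rfl; simp at hx
  simp only [sum_Ico_zpow_div_eq hx0 a hp]
  refine hasSum_conditional_nat_iff.1 (hasSum_cycHurwitzComb hx ha hp ?_)
  rintro rfl rfl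
  simp

theorem cycHurwitzComb_neg_self {x a : ℂ} (hx : ‖x‖ = 1) (ha : ∀ m : ℤ, a ≠ (m : ℂ)) :
    cycHurwitzComb (-x) 1 1 x a = -bilateralSum x a 1 := by
  have h1 := hasSum_cycHurwitzComb hx ha (u := -x) (v := 1) le_rfl (by rintro - rfl; simp)
  have h2 := (hasSum_cycHurwitzComb hx ha (u := x) (v := -(-1) ^ (1 - 1)) le_rfl
    (by rintro - rfl; simp)).neg
  refine h1.unique (h2.congr_fun fun n => ?_)
  simp
  ring

/-! ### The central binomial series and assembly -/

theorem centralTerm_eq (r : ℕ) (x : ℂ) (n : ℕ) : centralTerm (r + 1) x n =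
    (centralRatio (n + 1) : ℂ) * (x ^ (n + 1) / ((n + 1 : ℕ) : ℂ) ^ r) := by
  rw [centralTerm, centralRatio, Nat.centralBinom, Nat.add_sub_cancel]
  push_cast
  have h4 : (n : ℂ) + 1 ≠ 0 := by exact_mod_cast n.succ_ne_zero
  field_simp

theorem summable_centralTerm_succ {x : ℂ} (hx : ‖x‖ = 1) {r : ℕ} (hr : 1 ≤ r) :
    Summable (centralTerm (r + 1) x) := by
  obtain ⟨r, rfl⟩ := Nat.exists_eq_add_of_le' hr
  refine Summable.of_norm ((summable_centralRatio_succ_div_pow r).congr fun n => ?_)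
  have h6 : ‖((n + 1 : ℕ) : ℂ)‖ = (n : ℝ) + 1 := by exact_mod_cast Complex.norm_natCast (n + 1)
  rw [centralTerm_eq, norm_mul, Complex.norm_real, Real.norm_of_nonneg (centralRatio_pos _).le,
    norm_div, norm_pow, norm_pow, hx, one_pow, h6, mul_one_div]

theorem summable_centralTerm {x : ℂ} (hx : ‖x‖ = 1) {r : ℕ} (hrx : r = 0 → x ≠ 1) :
    Summable (centralTerm (r + 1) x) (conditional ℕ) := by
  rcases Nat.eq_zero_or_pos r with rfl | hr
  · refine (summable_conditional_mul_pow hx (hrx rfl) (b := fun m => centralRatio (m + 1))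
      (fun m n h => centralRatio_antitone (by lia))
      ((tendsto_add_atTop_iff_nat 1).2 centralRatio_tendsto)).congr fun n => ?_
    rw [centralTerm_eq, pow_zero, div_one]
  · exact (summable_centralTerm_succ hx hr).mono_filter (conditional ℕ).le_atTop

theorem tsum_centralRatio_mul_shiftedLimit {x : ℂ} (hx : ‖x‖ = 1) (K : ℕ → ℂ) {r : ℕ}
    (hr : 1 ≤ r) : ∑' m : ℕ, (centralRatio (m + 1) : ℂ) * shiftedLimit K x (m + 1) r =
      (-1) ^ r * K 1 * ∑' n, centralTerm (r + 1) x n +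
        ∑ j ∈ Finset.range r, (betaTaylor (j + 1) : ℂ) * K (r - j) := by
  have h1 := (summable_centralTerm_succ hx hr).hasSum.mul_left ((-1) ^ r * K 1)
  have h2 : ∀ j : ℕ, HasSum (fun m : ℕ => (-1) ^ j * K (r - j) *
      ((centralRatio (m + 1) / ((m : ℝ) + 1) ^ (j + 1) : ℝ) : ℂ))
      ((betaTaylor (j + 1) : ℂ) * K (r - j)) := fun j => by
    have h3 := (Complex.hasSum_ofReal.2 (summable_centralRatio_succ_div_pow j).hasSum).mul_left
      ((-1) ^ j * K (r - j))
    have h5 : (betaTaylor (j + 1) : ℂ) * K (r - j) = (-1) ^ j * K (r - j) *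
        ((∑' m : ℕ, centralRatio (m + 1) / ((m : ℝ) + 1) ^ (j + 1) : ℝ) : ℂ) := by
      simp only [betaTaylor]
      push_cast
      ring
    rw [h5]
    exact h3
  refine ((h1.add (hasSum_sum fun j _ => h2 j)).congr_fun fun m => ?_).tsum_eq
  rw [shiftedLimit_eq K x (m := m + 1) m.succ_ne_zero, mul_add, centralTerm_eq, Finset.mul_sum]
  congr 1
  · ring
  · refine Finset.sum_congr rfl fun j _ => ?_
    push_cast
    ring

theorem hasSum_aperyTerm {x a : ℂ} (hx : ‖x‖ = 1) (ha : ∀ m : ℤ, a ≠ (m : ℂ)) {r : ℕ}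
    (hrx : r = 0 → x ≠ 1) : HasSum (aperyTerm (r + 1) x a)
      ((-1) ^ r * bilateralSum x a 1 * ∑'[conditional ℕ] n, centralTerm (r + 1) x n +
        ∑ j ∈ Finset.range (r + 1), (betaTaylor j : ℂ) * bilateralSum x a (r - j + 1))
      (conditional ℤ) := by
  have hK := tendsto_bilateralSum hx ha
  have hC := summable_centralTerm hx hrx
  rcases Nat.eq_zero_or_pos r with rfl | hr
  · have h1 := hasSum_conditional_nat_iff.1 hC.hasSum
    simp only [centralTerm_eq, pow_zero, div_one] at h1
    -- In `K 1 * (1 + P)`, the `1` is the Taylor term `j = 0` and `P` is the central series.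
    have h2 := hasSum_zpow_mul_betaSum hx (hrx rfl) ha hK h1
    convert! h2.congr_fun fun n => ?_ using 1
    · simp [betaTaylor, centralTerm_eq]
      ring
    · rw [aperyTerm_eq ha, pow_zero, div_one]
  · have h1 := (hasSum_zpow_mul_betaSum_div hx ha hK hr).mono_left (conditional ℤ).le_atTop
    have h2 := (summable_centralTerm_succ hx hr).hasSum.mono_left (conditional ℕ).le_atTop
    rw [tsum_centralRatio_mul_shiftedLimit hx _ hr] at h1
    have h3 : ∑ j ∈ Finset.range r, (betaTaylor (j + 1) : ℂ) * bilateralSum x a (r - (j + 1) + 1) =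
        ∑ j ∈ Finset.range r, (betaTaylor (j + 1) : ℂ) * bilateralSum x a (r - j) := by
      refine Finset.sum_congr rfl fun j hj => ?_
      have := Finset.mem_range.1 hj
      rw [show r - (j + 1) + 1 = r - j by lia]
    -- The split-off term `j = 0` is `K (r + 1)`, the contribution of the pole `m = 0`.
    rw [Finset.sum_range_succ', h3, hC.hasSum.unique h2]
    have h4 : HasSum (aperyTerm (r + 1) x a) _ (conditional ℤ) :=
      HasSum.congr_fun h1 fun n => aperyTerm_eq ha x r n
    convert! h4 using 1
    simp only [betaTaylor, Nat.sub_zero]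
    push_cast
    ring

end

theorem theorem2p1 (x a : ℂ) (q : ℕ)
    (hx : ∃ N : ℕ, 0 < N ∧ x ^ N = 1)
    (ha : ∀ m : ℤ, a ≠ (m : ℂ))
    (hq : 1 ≤ q) (hqx : ¬ (q = 1 ∧ x = 1)) :
    -- convergence of every series that occurs
    (∀ p : ℕ, 1 ≤ p → ¬ (p = 1 ∧ x = 1) →
      Summable (cycHurwitzTerm p x⁻¹ a) (conditional ℕ) ∧
      Summable (cycHurwitzTerm p x (1 - a)) (conditional ℕ)) ∧
    Summable (fun n => cycHurwitzTerm 1 x (1 - a) n - x * cycHurwitzTerm 1 x⁻¹ a n)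
      (conditional ℕ) ∧
    Summable (aperyTerm q x a) (conditional ℤ) ∧
    Summable (centralTerm q x) (conditional ℕ) ∧
    -- the identity
    (∑'[conditional ℤ] n, aperyTerm q x a n)
        - (-1) ^ q * cycHurwitzComb (-x) 1 1 x a * ∑'[conditional ℕ] n, centralTerm q x n
      = ∑ k ∈ Finset.Nat.antidiagonalTuple 5 (q - 1),
          bellC (k 0) * bellC (k 1) * bellD (k 2) * 2 ^ (k 2 + k 3)
              / (((k 0)! : ℂ) * ((k 1)! : ℂ) * ((k 2)! : ℂ) * ((k 3)! : ℂ))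
            * (Real.log 2 : ℂ) ^ (k 3)
            * cycHurwitzComb x (-(-1) ^ (k 4)) (k 4 + 1) x a := by
  obtain ⟨N, hN, hxN⟩ := hx
  have hx : ‖x‖ = 1 := Complex.norm_eq_one_of_pow_eq_one hxN hN.ne'
  have hx' : ‖x⁻¹‖ = 1 := by rw [norm_inv, hx, inv_one]
  obtain ⟨r, rfl⟩ := Nat.exists_eq_add_of_le' hq
  have hrx : r = 0 → x ≠ 1 := fun h h' => hqx ⟨by lia, h'⟩
  have hA := hasSum_aperyTerm hx ha hrx
  refine ⟨fun p hp hpx => ⟨summable_cycHurwitzTerm hx' ha hp (by simpa using hpx),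
    summable_cycHurwitzTerm hx (ne_intCast_one_sub ha) hp hpx⟩, ?_, hA.summable,
    summable_centralTerm hx hrx, ?_⟩
  · refine (hasSum_cycHurwitzComb hx ha (u := -x) (v := 1) (p := 1) le_rfl
      (by rintro - rfl; simp)).summable.congr fun n => ?_
    ring
  · rw [hA.tsum_eq, cycHurwitzComb_neg_self hx ha, Nat.add_sub_cancel]
    have h := sum_bell_eq (fun k => cycHurwitzComb x (-(-1) ^ k) (k + 1) x a) r
    rw [h]
    simp only [bilateralSum, Nat.add_sub_cancel]
    ring
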